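/- Let $G$ be a second countable locally compact group, let $A$ and $B$ be (not necessarily unital) $C^*$-algebras with $A$ separable, both equipped with actions of $G$ by $*$-automorphisms such that $g\mapsto ga$ and $g\mapsto gb$ are norm continuous for all $a\in A$, $b\in B$, and let $I\subseteq B$ be a closed two-sided $G$-invariant ideal. Let $\pi:B\to B/I$ be the quotient map, and give $B/I$ the induced action of $G$. Conventions. A path $\psi=(\psi_t)_{t\in[1,\infty)}$ of (not necessarily linear) maps $\psi_t:A\to B$ is called *asymptotically cp* if - for each $a\in A$ the map $t\mapsto\psi_t(a)$ is continuous and bounded on $[1,\infty)$; - each $\psi_t$ is selfadjoint, i.e. $\psi_t(a^*)=\psi_t(a)^*$ for all $a\in A$; - $\lim_{t\to\infty}\|\psi_t(\mu a+\nu b)-\mu\psi_t(a)-\nu\psi_t(b)\|=0$ for all $a,b\in A$ and $\mu,\nu\in\mathbb C$; - for every $n$ and every positive $M\in M_n(A)$, the negative part of the entrywise image satisfies $\lim_{t\to\infty}\|(\psi_t^{(n)}(M))_-\|=0$. The path is *contractive* if $\|\psi_t(a)\|\le\|a\|$ for all $t,a$; it is *positive* if $\psi_t(a)\ge0$ whenever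 $a\ge0$, for all $t$; it is a *lift* of $\phi:A\to B/I$ if $\pi\circ\psi_t=\phi$ for all $t$. It is *asymptotically equivariant* if $\lim_{t\to\infty}\sup_{g\in K}\|g\psi_t(a)-\psi_t(ga)\|=0$ for every $a\in A$ and every compact $K\subseteq G$. It is *asymptotically order zero* if $\lim_{t\to\infty}\|\psi_t(a)\psi_t(b)\|=0$ for all positive $a,b\in A$ with $ab=0$. A completely positive map $\phi$ is *order zero* if $\phi(a)\phi(b)=0$ for all positive $a,b\in A$ with $ab=0$. **Proposition.** Let $\phi:A\to B/I$ be a contractive completely positive linear map, and suppose that $\phi$ has an asymptotically cp lift $(\psi_t)_{t\in[1,\infty)}$. Then $\phi$ has an asymptotically cp lift $(\bar\psi_t)_{t\in[1,\infty)}$, which is contractive if $(\psi_t)$ is contractive and positive if $(\psi_t)$ is positive, such that: 1. $\lim_{t\to\infty}\|\bar\psi_t(a)\bar\psi_t(b)\|=\|\phi(a)\phi(b)\|$ for all $a,b\in A$; 2. for every $a\in A$ and every compact $K\subseteq G$, $\|g\bar\psi_t(a)-\bar\psi_t(ha)\|\to\|g\phi(a)-\phi(ha)\|$ as $t\to\infty$,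 uniformly in $(g,h)\in K\times K$; in particular $$\lim_{t\to\infty}\ \sup_{g,h\in K}\|g\bar\psi_t(a)-\bar\psi_t(ha)\|=\sup_{g,h\in K}\|g\phi(a)-\phi(ha)\|;$$ 3. if $\phi$ is equivariant, then $(\bar\psi_t)$ is asymptotically equivariant; 4. if $\phi$ is order zero, then $(\bar\psi_t)$ is asymptotically order zero. -/

import Mathlib

open Filter Topology
open scoped CStarAlgebra

/-- The negative part `x₋` of a selfadjoint element `x` of a C⋆-algebra (continuous functional
calculus with `r ↦ max (-r) 0`). -/
noncomputable def cstarNegPart {E : Type*} [NonUnitalCStarAlgebra E] (x : E) : E := x⁻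

section Paths

variable {A B Q : Type*} [NonUnitalCStarAlgebra A] [NonUnitalCStarAlgebra B]
  [NonUnitalCStarAlgebra Q]

/-- Each map of the path `ψ` is norm-nonincreasing (`ψ t` need not be linear). -/
def IsContractivePath (ψ : Set.Ici (1 : ℝ) → A → B) : Prop :=
  ∀ t a, ‖ψ t a‖ ≤ ‖a‖

/-- Each map `ψ t` is a lift of `φ` through `π`. -/
def IsLiftPath (π : B →⋆ₙₐ[ℂ] Q) (φ : A → Q) (ψ : Set.Ici (1 : ℝ) → A → B) : Prop :=
  ∀ t a, π (ψ t a) = φ a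

variable [PartialOrder A] [StarOrderedRing A] [PartialOrder B] [StarOrderedRing B]
  [PartialOrder Q] [StarOrderedRing Q]

/-- Each map of the path `ψ` sends positive elements to positive elements. -/
def IsPositivePath (ψ : Set.Ici (1 : ℝ) → A → B) : Prop :=
  ∀ t a, 0 ≤ a → 0 ≤ ψ t a

/-- A path `(ψ_t)`, `t ∈ [1, ∞)`, of (not necessarily linear) maps between C⋆-algebras is
*asymptotically completely positive*: it is a bounded continuous path at each element, each `ψ_t`
is selfadjoint, the path is asymptotically linear, and for every `n` and every positive `M` in
`M_n(A)` the negative part of the amplification `ψ_t^{(n)}(M)` tends to zero in norm. Pointwise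
boundedness and asymptotic linearity say that `a ↦ [t ↦ ψ_t(a)]` is a linear map into
`C_b([1, ∞), B) / C_0([1, ∞), B)`. Since `ψ_t` is selfadjoint, `ψ_t^{(n)}(M)` is selfadjoint, so its
negative part is the genuine one. -/
structure IsAsymptoticallyCP (ψ : Set.Ici (1 : ℝ) → A → B) : Prop where
  continuous_path : ∀ a, Continuous fun t => ψ t a
  bounded : ∀ a, ∃ C : ℝ, ∀ t, ‖ψ t a‖ ≤ C
  map_star : ∀ t a, ψ t (star a) = star (ψ t a)
  asymptotically_linear : ∀ (μ ν : ℂ) (a b : A),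
    Tendsto (fun t => ‖ψ t (μ • a + ν • b) - μ • ψ t a - ν • ψ t b‖) atTop (𝓝 0)
  asymptotically_positive : ∀ (n : ℕ) (M : CStarMatrix (Fin n) (Fin n) A), 0 ≤ M →
    Tendsto (fun t => ‖cstarNegPart (M.map (ψ t))‖) atTop (𝓝 0)

/-- A completely positive map is *order zero* if it preserves orthogonality of positive
elements. -/
def IsOrderZero (φ : A →CP Q) : Prop :=
  ∀ a b : A, 0 ≤ a → 0 ≤ b → a * b = 0 → φ a * φ b = 0

/-- A path of maps is *asymptotically order zero* if it asymptotically preserves orthogonality of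
positive elements. -/
def IsAsymptoticallyOrderZero (ψ : Set.Ici (1 : ℝ) → A → B) : Prop :=
  ∀ a b : A, 0 ≤ a → 0 ≤ b → a * b = 0 → Tendsto (fun t => ‖ψ t a * ψ t b‖) atTop (𝓝 0)

end Paths

section Equivariance

variable {G A B : Type*} [Group G] [TopologicalSpace G] [NonUnitalCStarAlgebra A]
  [NonUnitalCStarAlgebra B]

/-- The action `α` of `G` by ⋆-automorphisms of `A` is point-norm continuous, i.e. it makes `A` a
`G`-algebra. -/
def IsContinuousAction (α : G →* (A ≃⋆ₐ[ℂ] A)) : Prop :=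
  ∀ a, Continuous fun g => α g a

/-- A path of maps is *asymptotically equivariant* if, for each `a`, the difference
`g ψ_t(a) - ψ_t(g a)` tends to zero uniformly for `g` in compact subsets of `G`. -/
def IsAsymptoticallyEquivariant (α : G →* (A ≃⋆ₐ[ℂ] A)) (β : G →* (B ≃⋆ₐ[ℂ] B))
    (ψ : Set.Ici (1 : ℝ) → A → B) : Prop :=
  ∀ (a : A) (K : Set G), IsCompact K →
    TendstoUniformlyOn (fun t g => ‖β g (ψ t a) - ψ t (α g a)‖) (fun _ => (0 : ℝ)) atTop K

end Equivariance

/-! The new path is modelled on the compressions `(1 - u t) ψ t a (1 - u t)`, where `u` is a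
continuous path of positive contractions in `ker π`. Compressing does not change the image under
`π`, so lifts stay lifts. Since `π` and the actions are norm-nonincreasing, the norms in (1) and (2)
are bounded below by the corresponding norms in `Q` at every time, and only upper bounds need work.
These come from two properties of `u`. An approximate unit of the ideal brings `‖x - x * u‖` down to
`‖π x‖`. If `u` also asymptotically commutes with the values of `ψ` and is asymptotically invariant,
then products and differences `g x - y` of compressions are controlled by `‖z - z * u‖`, with `z`
the same expression before compression.

Such `u` come from `exists_quasicentral_invariant`, a convexity argument: in the convex set of
approximate units for a compact part of the ideal, commutators and displacements can be made small
in norm because they can be made almost orthogonal to any given ideal-valued function.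

Only the values of `ψ` on a dense sequence `d` can be handled this way, and `ψ t` need not be
continuous in `a`. However, an asymptotically cp path is asymptotically Lipschitz
(`exists_eventually_norm_sub_le`), by a uniform boundedness argument on positive elements. In
`exists_isLocallyAsymptotic` the argument `a` is therefore replaced by its best approximation in a
slowly growing finite part of `d`, and the defect is corrected by a small lift. The result is
asymptotic to the compression even when `a` moves in a shrinking neighbourhood; this gives
uniformity over `h` in a compact set, where the argument is `h a`. Averaging with the involution and
cutting off by functional calculus then make the path selfadjoint, positive and contractive without
leaving this asymptotic class. Claims (3) and (4) are special cases of (2) and (1). -/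

/-! ### Negative parts under perturbation. -/

section NegPart

variable {E : Type*} [NonUnitalCStarAlgebra E] [PartialOrder E] [StarOrderedRing E]

/-- A lower bound by a negative element controls the negative part. -/
theorem norm_negPart_le_of_neg_le {x z : E} (hx : IsSelfAdjoint x) (h : -z ≤ x) :
    ‖x⁻‖ ≤ ‖z‖ := by
  set y := x⁻ with hy
  have hy0 : 0 ≤ y := CFC.negPart_nonneg x
  have hys : star y = y := hy0.isSelfAdjoint.star_eq
  have h1 : star y * (-z) * y ≤ star y * x * y := star_left_conjugate_le_conjugate h y
  -- Conjugation by `x⁻` annihilates the positive part of `x`.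
  have h2 : y * x * y = -(y * y * y) := by
    conv_lhs => rw [← CFC.posPart_sub_negPart x hx]
    rw [mul_sub, hy, CFC.negPart_mul_posPart, zero_sub, neg_mul]
  rw [hys, h2] at h1
  have h3 : y * y * y ≤ y * z * y := by
    have := neg_le_neg h1
    simpa using this
  have h4 : 0 ≤ y * y * y := by
    have := star_left_conjugate_nonneg hy0 y
    rwa [hys] at this
  have h5 : ‖y * y * y‖ ≤ ‖y * z * y‖ := CStarAlgebra.norm_le_norm_of_nonneg_of_le h4 h3
  have h6 : ‖y * z * y‖ ≤ ‖y‖ * ‖z‖ * ‖y‖ :=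
    (norm_mul_le _ _).trans (mul_le_mul_of_nonneg_right (norm_mul_le _ _) (norm_nonneg _))
  -- The C⋆-identity evaluates norms of even powers; the cube is bounded below through the fourth
  -- power.
  have h7 : ‖y‖ ^ 4 ≤ ‖y * y * y‖ * ‖y‖ := by
    have e1 : ‖y * y‖ = ‖y‖ * ‖y‖ := by
      have := CStarRing.norm_star_mul_self (x := y); rwa [hys] at this
    have e2 : ‖(y * y) * (y * y)‖ = ‖y * y‖ * ‖y * y‖ := by
      have := CStarRing.norm_star_mul_self (x := y * y)
      rwa [star_mul, hys] at this
    calc ‖y‖ ^ 4 = ‖(y * y) * (y * y)‖ := by rw [e2, e1]; ring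
      _ = ‖(y * y * y) * y‖ := by rw [mul_assoc (y * y)]
      _ ≤ _ := norm_mul_le _ _
  rcases (norm_nonneg y).eq_or_lt with h0 | h0
  · rw [← h0]; exact norm_nonneg _
  · by_contra! hc
    have : ‖y‖ ^ 4 ≤ ‖y‖ ^ 3 * ‖z‖ := by nlinarith [norm_nonneg y]
    have h9 : ‖y‖ ^ 3 * ‖z‖ < ‖y‖ ^ 3 * ‖y‖ := mul_lt_mul_of_pos_left hc (by positivity)
    nlinarith

theorem norm_negPart_le_add {x y : E} (hx : IsSelfAdjoint x) (hy : IsSelfAdjoint y) :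
    ‖x⁻‖ ≤ ‖y⁻‖ + ‖x - y‖ := by
  have h : -(y⁻ + (x - y)⁻) ≤ x := by
    have h1 := CFC.neg_negPart_le hy
    have h2 := CFC.neg_negPart_le (hx.sub hy)
    calc -(y⁻ + (x - y)⁻) = -y⁻ + -(x - y)⁻ := by abel
      _ ≤ y + (x - y) := add_le_add h1 h2
      _ = x := by abel
  calc ‖x⁻‖ ≤ ‖y⁻ + (x - y)⁻‖ := norm_negPart_le_of_neg_le hx h
    _ ≤ ‖y⁻‖ + ‖(x - y)⁻‖ := norm_add_le _ _
    _ ≤ _ := by gcongr; exact CStarAlgebra.norm_negPart_le _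

end NegPart

/-! ### Compression by `1 - u`. -/

section Compress

variable {E : Type*} [NonUnitalCStarAlgebra E]

/-- The compression `(1 - u) x (1 - u)`, written without a unit. -/
def compress (u x : E) : E := (x - u * x) - (x - u * x) * u

theorem inr_compress (u x : E) :
    ((compress u x : E) : Unitization ℂ E) = (1 - (u : Unitization ℂ E)) * x * (1 - u) := by
  simp only [compress, Unitization.inr_sub, Unitization.inr_mul]
  noncomm_ring

theorem compress_sub (u x y : E) : compress u (x - y) = compress u x - compress u y := by
  simp only [compress, mul_sub, sub_mul]; abel

theorem compress_add (u x y : E) : compress u (x + y) = compress u x + compress u y := by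
  simp only [compress, mul_add, add_mul, sub_mul]; abel

theorem compress_smul (u x : E) (c : ℂ) : compress u (c • x) = c • compress u x := by
  simp only [compress, mul_smul_comm, smul_mul_assoc, smul_sub, sub_mul]

theorem map_compress {F : Type*} [NonUnitalCStarAlgebra F] {𝓕 : Type*} [FunLike 𝓕 E F]
    [NonUnitalRingHomClass 𝓕 E F] (f : 𝓕) (u x : E) :
    f (compress u x) = compress (f u) (f x) := by
  simp [compress]

theorem compress_zero_left (x : E) : compress 0 x = x := by simp [compress]

theorem star_compress {u : E} (hu : IsSelfAdjoint u) (x : E) :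
    star (compress u x) = compress u (star x) := by
  simp only [compress, star_sub, star_mul, hu.star_eq, sub_mul, mul_assoc]; abel

variable [PartialOrder E] [StarOrderedRing E]

theorem norm_one_sub_inr_le {u : E} (hu : 0 ≤ u) (hu1 : ‖u‖ ≤ 1) :
    ‖(1 - (u : Unitization ℂ E))‖ ≤ 1 := by
  have h0 : (0 : Unitization ℂ E) ≤ u := Unitization.inr_nonneg_iff.mpr hu
  have h1 : (u : Unitization ℂ E) ≤ 1 := by
    rw [← CStarAlgebra.norm_le_one_iff_of_nonneg _ h0, Unitization.norm_inr]; exact hu1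
  rw [CStarAlgebra.norm_le_one_iff_of_nonneg _ (sub_nonneg.mpr h1)]
  simpa using h0

theorem norm_sub_right_mul_le {u : E} (hu : 0 ≤ u) (hu1 : ‖u‖ ≤ 1) (x : E) : ‖x - x * u‖ ≤ ‖x‖ := by
  rw [← Unitization.norm_inr (𝕜 := ℂ) (x - x * u), ← Unitization.norm_inr (𝕜 := ℂ) x]
  have : ((x - x * u : E) : Unitization ℂ E) = x * (1 - u) := by
    simp [mul_sub, Unitization.inr_sub]
  rw [this]
  exact (norm_mul_le _ _).trans (mul_le_of_le_one_right (norm_nonneg _) (norm_one_sub_inr_le hu hu1))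

theorem norm_sub_left_mul_le {u : E} (hu : 0 ≤ u) (hu1 : ‖u‖ ≤ 1) (x : E) : ‖x - u * x‖ ≤ ‖x‖ := by
  have := norm_sub_right_mul_le hu hu1 (star x)
  rw [← norm_star, star_sub, star_mul, hu.isSelfAdjoint.star_eq]
  simpa using this

theorem norm_compress_le {u : E} (hu : 0 ≤ u) (hu1 : ‖u‖ ≤ 1) (x : E) :
    ‖compress u x‖ ≤ ‖x - x * u‖ := by
  have : compress u x = (x - x * u) - u * (x - x * u) := by
    simp only [compress, sub_mul, mul_sub, mul_assoc]; abel
  rw [this]; exact norm_sub_left_mul_le hu hu1 _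

theorem norm_compress_le_norm {u : E} (hu : 0 ≤ u) (hu1 : ‖u‖ ≤ 1) (x : E) :
    ‖compress u x‖ ≤ ‖x‖ := (norm_compress_le hu hu1 x).trans (norm_sub_right_mul_le hu hu1 x)

theorem compress_nonneg {u x : E} (hu : IsSelfAdjoint u) (hx : 0 ≤ x) : 0 ≤ compress u x := by
  rw [← Unitization.inr_nonneg_iff (A := E), inr_compress]
  have hs : star (1 - (u : Unitization ℂ E)) = 1 - u := by
    rw [star_sub, star_one, ← Unitization.inr_star, hu.star_eq]
  have := star_left_conjugate_nonneg (Unitization.inr_nonneg_iff.mpr hx) (1 - (u : Unitization ℂ E))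
  rwa [hs] at this

/-- Since `x ≥ -x⁻` and compression is positive, the compression of `x` dominates minus that of
`x⁻`, whose norm is at most `‖x⁻‖`. -/
theorem norm_negPart_compress_le {u x : E} (hu : 0 ≤ u) (hu1 : ‖u‖ ≤ 1) (hx : IsSelfAdjoint x) :
    ‖(compress u x)⁻‖ ≤ ‖x⁻‖ := by
  refine (norm_negPart_le_of_neg_le (z := compress u x⁻) ?_ ?_).trans
    (norm_compress_le_norm hu hu1 _)
  · rw [IsSelfAdjoint, star_compress hu.isSelfAdjoint, hx.star_eq]
  · have h := compress_nonneg hu.isSelfAdjoint (CFC.posPart_nonneg x)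
    have e : x⁺ = x + x⁻ := sub_eq_iff_eq_add.mp (CFC.posPart_sub_negPart x hx)
    rw [e, compress_add] at h
    exact neg_le_iff_add_nonneg.mpr h

/-- Compressions are multiplicative up to commutators with the compressing element. -/
theorem norm_compress_mul_compress_le {u : E} (hu : 0 ≤ u) (hu1 : ‖u‖ ≤ 1) (x y : E) :
    ‖compress u x * compress u y‖ ≤ ‖x * y - x * y * u‖ + 2 * ‖x‖ * ‖u * y - y * u‖ := by
  have hv := norm_one_sub_inr_le hu hu1
  rw [← Unitization.norm_inr (𝕜 := ℂ) (compress u x * _), ← Unitization.norm_inr (𝕜 := ℂ) x,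
    ← Unitization.norm_inr (𝕜 := ℂ) (x * y - _), ← Unitization.norm_inr (𝕜 := ℂ) (u * y - y * u)]
  simp only [Unitization.inr_sub, Unitization.inr_mul, inr_compress]
  generalize (x : Unitization ℂ E) = X
  generalize (y : Unitization ℂ E) = Y
  generalize (u : Unitization ℂ E) = U at *
  set V := 1 - U with hV
  have hV2 : ‖V * V‖ ≤ 1 := (norm_mul_le _ _).trans (by nlinarith [norm_nonneg V])
  -- Both middle factors `V` are moved to the right of `Y`; each passage costs one commutator of `U`
  -- with `Y`.
  have key : V * X * V * (V * Y * V)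
      = V * ((X * Y - X * Y * U) * (V * V))
        - V * X * ((V * (U * Y - Y * U) + (U * Y - Y * U) * V) * V) := by
    rw [hV]; noncomm_ring
  rw [key]
  have n1 : ‖V * ((X * Y - X * Y * U) * (V * V))‖ ≤ ‖X * Y - X * Y * U‖ := by
    calc _ ≤ ‖V‖ * (‖X * Y - X * Y * U‖ * ‖V * V‖) :=
          (norm_mul_le _ _).trans (by gcongr; exact norm_mul_le _ _)
      _ ≤ 1 * (‖X * Y - X * Y * U‖ * 1) := by gcongr
      _ = _ := by ring
  set W := U * Y - Y * U
  have n2 : ‖V * X * ((V * W + W * V) * V)‖ ≤ 2 * ‖X‖ * ‖W‖ := by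
    calc _ ≤ (‖V‖ * ‖X‖) * ((‖V‖ * ‖W‖ + ‖W‖ * ‖V‖) * ‖V‖) := by
          refine (norm_mul_le _ _).trans ?_
          gcongr
          · exact norm_mul_le _ _
          · refine (norm_mul_le _ _).trans ?_
            gcongr
            refine (norm_add_le _ _).trans ?_
            gcongr <;> exact norm_mul_le _ _
      _ ≤ (1 * ‖X‖) * ((1 * ‖W‖ + ‖W‖ * 1) * 1) := by gcongr
      _ = _ := by ring
  exact (norm_sub_le _ _).trans (by linarith)

theorem norm_compress_sub_compress_le {u u' : E} (hu : 0 ≤ u) (hu1 : ‖u‖ ≤ 1) (hu' : 0 ≤ u')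
    (hu1' : ‖u'‖ ≤ 1) (x : E) : ‖compress u x - compress u' x‖ ≤ 2 * ‖u - u'‖ * ‖x‖ := by
  have hv := norm_one_sub_inr_le hu hu1
  have hv' := norm_one_sub_inr_le hu' hu1'
  rw [← Unitization.norm_inr (𝕜 := ℂ) (compress u x - _), ← Unitization.norm_inr (𝕜 := ℂ) x,
    ← Unitization.norm_inr (𝕜 := ℂ) (u - u')]
  simp only [Unitization.inr_sub, inr_compress]
  generalize (x : Unitization ℂ E) = X
  generalize (u : Unitization ℂ E) = U at *
  generalize (u' : Unitization ℂ E) = U' at *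
  have key : (1 - U) * X * (1 - U) - (1 - U') * X * (1 - U')
      = -((U - U') * (X * (1 - U))) - (1 - U') * (X * (U - U')) := by noncomm_ring
  rw [key]
  refine (norm_sub_le _ _).trans ?_
  rw [norm_neg]
  have n1 : ‖(U - U') * (X * (1 - U))‖ ≤ ‖U - U'‖ * (‖X‖ * 1) :=
    (norm_mul_le _ _).trans (by gcongr; exact (norm_mul_le _ _).trans (by gcongr))
  have n2 : ‖(1 - U') * (X * (U - U'))‖ ≤ 1 * (‖X‖ * ‖U - U'‖) :=
    (norm_mul_le _ _).trans (by gcongr; exact (norm_mul_le _ _))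
  linarith

end Compress

/-! ### Norm cutoffs and norm-preserving lifts. -/

section Cutoff

variable {E : Type*} [NonUnitalCStarAlgebra E] [PartialOrder E] [StarOrderedRing E]

/-- The function `s ↦ 1 - r / √s` for `s ≥ r ^ 2`, extended by `0`. -/
noncomputable def cutoffFun (r s : ℝ) : ℝ := 1 - r / √(max s (r ^ 2))

theorem continuous_cutoffFun {r : ℝ} (hr : 0 < r) : Continuous (cutoffFun r) := by
  unfold cutoffFun
  refine continuous_const.sub (continuous_const.div (by fun_prop) fun s => ?_)
  have : 0 < max s (r ^ 2) := lt_max_of_lt_right (by positivity)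
  positivity

theorem cutoffFun_of_le {r s : ℝ} (hr : 0 < r) (hs : s ≤ r ^ 2) : cutoffFun r s = 0 := by
  rw [cutoffFun, max_eq_right hs, Real.sqrt_sq hr.le, div_self hr.ne', sub_self]

theorem sqrt_mul_cutoffFun {r s : ℝ} (hr : 0 < r) (hs : r ^ 2 ≤ s) :
    √s * cutoffFun r s = √s - r := by
  have : 0 < √s := Real.sqrt_pos.mpr (lt_of_lt_of_le (by positivity) hs)
  rw [cutoffFun, max_eq_left hs]
  field_simp

/-- Cut a (not necessarily selfadjoint) element down to norm at most `r`. -/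
noncomputable def cutoff (r : ℝ) (x : E) : E :=
  if 0 < r then x - x * cfcₙ (cutoffFun r) (star x * x) else 0

omit [PartialOrder E] [StarOrderedRing E] in
/-- The norm of `x * f (x * x)` for a real function `f`. -/
theorem norm_mul_cfcₙ_sq (f : ℝ → ℝ) (hf : Continuous f) (hf0 : f 0 = 0) (x : E) :
    ‖x * cfcₙ f (star x * x)‖ ^ 2 = ‖cfcₙ (fun s => f s * s * f s) (star x * x)‖ := by
  have hs : IsSelfAdjoint (star x * x) := IsSelfAdjoint.star_mul_self x
  have h1 : IsSelfAdjoint (cfcₙ f (star x * x)) := cfcₙ_predicate f _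
  rw [sq, ← CStarRing.norm_star_mul_self, star_mul, h1.star_eq]
  rw [cfcₙ_mul (fun s => f s * s) f (star x * x), cfcₙ_mul f (fun s => s) (star x * x),
    cfcₙ_id' ℝ (star x * x)]
  simp only [mul_assoc]

omit [PartialOrder E] [StarOrderedRing E] in
theorem compress_cfcₙ {f : ℝ → ℝ} (hf : Continuous f) (hf0 : f 0 = 0) {h : E}
    (hh : IsSelfAdjoint h) :
    compress (cfcₙ f h) h = cfcₙ (fun s => (s - f s * s) - (s - f s * s) * f s) h := by
  rw [cfcₙ_sub (fun s => s - f s * s) (fun s => (s - f s * s) * f s) h,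
    cfcₙ_mul (fun s => s - f s * s) f h, cfcₙ_sub (fun s => s) (fun s => f s * s) h,
    cfcₙ_mul f (fun s => s) h, cfcₙ_id' ℝ h, compress]

theorem quasispectrum_star_mul_self_mem {x : E} {s : ℝ} (hs : s ∈ quasispectrum ℝ (star x * x)) :
    0 ≤ s ∧ s ≤ ‖x‖ ^ 2 := by
  refine ⟨quasispectrum_nonneg_of_nonneg _ (star_mul_self_nonneg x) s hs, ?_⟩
  have := NonUnitalIsometricContinuousFunctionalCalculus.norm_quasispectrum_le (𝕜 := ℝ) (star x * x) hs
    (IsSelfAdjoint.star_mul_self x)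
  rw [CStarRing.norm_star_mul_self, ← sq] at this
  exact (le_abs_self s).trans this

/-- For `r > 0` the cutoff is `x * min(1, r / |x|)`, whose absolute value is `min(|x|, r)`.
Functional calculus is applied to `star x * x` only, so `x` may be arbitrary. -/
theorem norm_cutoff_le {r : ℝ} (hr : 0 ≤ r) (x : E) : ‖cutoff r x‖ ≤ r := by
  unfold cutoff
  split_ifs with h
  swap; · simpa using hr
  have hs : IsSelfAdjoint (star x * x) := IsSelfAdjoint.star_mul_self x
  have hc := continuous_cutoffFun h
  have h0 : cutoffFun r 0 = 0 := cutoffFun_of_le h (by positivity)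
  have h1 : IsSelfAdjoint (cfcₙ (cutoffFun r) (star x * x)) := cfcₙ_predicate _ _
  refine (sq_le_sq₀ (norm_nonneg _) hr).mp ?_
  have e : star (x - x * cfcₙ (cutoffFun r) (star x * x)) * (x - x * cfcₙ (cutoffFun r) (star x * x))
      = compress (cfcₙ (cutoffFun r) (star x * x)) (star x * x) := by
    rw [star_sub, star_mul, h1.star_eq, compress]
    noncomm_ring
  rw [sq, ← CStarRing.norm_star_mul_self, e, compress_cfcₙ hc h0 hs]
  refine norm_cfcₙ_le fun s hs => ?_
  obtain ⟨hs0, hs1⟩ := quasispectrum_star_mul_self_mem hs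
  rcases le_total s (r ^ 2) with hsr | hsr
  · simp only [cutoffFun_of_le h hsr]; simp [abs_of_nonneg hs0, hsr]
  · have e : (s - cutoffFun r s * s) - (s - cutoffFun r s * s) * cutoffFun r s
        = (√s - √s * cutoffFun r s) ^ 2 := by
      linear_combination -(1 - cutoffFun r s) ^ 2 * Real.sq_sqrt hs0
    rw [e, sqrt_mul_cutoffFun h hsr, sub_sub_cancel, Real.norm_of_nonneg (sq_nonneg _)]

theorem norm_cutoff_sub_le (r : ℝ) (hr : 0 ≤ r) (x : E) : ‖cutoff r x - x‖ ≤ max 0 (‖x‖ - r) := by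
  unfold cutoff
  split_ifs with h
  swap
  · have : r = 0 := le_antisymm (not_lt.mp h) hr
    simp [this]
  rw [sub_sub_cancel_left, norm_neg]
  have hc := continuous_cutoffFun h
  have h0 : cutoffFun r 0 = 0 := cutoffFun_of_le h (by positivity)
  refine (sq_le_sq₀ (norm_nonneg _) (le_max_left _ _)).mp ?_
  rw [norm_mul_cfcₙ_sq _ hc h0]
  refine norm_cfcₙ_le fun s hs => ?_
  obtain ⟨hs0, hs1⟩ := quasispectrum_star_mul_self_mem hs
  rcases le_total s (r ^ 2) with hsr | hsr
  · simp [cutoffFun_of_le h hsr]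
  · have e : cutoffFun r s * s * cutoffFun r s = (√s - r) ^ 2 := by
      rw [← sqrt_mul_cutoffFun h hsr, mul_pow, Real.sq_sqrt hs0]; ring
    rw [e, Real.norm_of_nonneg (sq_nonneg _)]
    have e1 : r ≤ √s := Real.le_sqrt_of_sq_le hsr
    have e2 : √s ≤ ‖x‖ := Real.sqrt_le_iff.mpr ⟨norm_nonneg _, hs1⟩
    have : 0 ≤ √s - r := by linarith
    gcongr
    exact le_max_of_le_right (by linarith)

theorem cutoff_of_norm_le {r : ℝ} (hr : 0 ≤ r) {x : E} (hx : ‖x‖ ≤ r) : cutoff r x = x := by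
  have := norm_cutoff_sub_le r hr x
  rw [max_eq_left (by linarith)] at this
  exact sub_eq_zero.mp (norm_le_zero_iff.mp this)

omit [PartialOrder E] [StarOrderedRing E] in
theorem map_cutoff {F : Type*} [NonUnitalCStarAlgebra F] (f : E →⋆ₙₐ[ℂ] F) (r : ℝ) (x : E) :
    f (cutoff r x) = cutoff r (f x) := by
  unfold cutoff
  split_ifs with h
  swap; · simp
  have hc := continuous_cutoffFun h
  have h0 : cutoffFun r 0 = 0 := cutoffFun_of_le h (by positivity)
  have hs : IsSelfAdjoint (star x * x) := IsSelfAdjoint.star_mul_self x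
  rw [map_sub, map_mul, NonUnitalStarAlgHom.map_cfcₙ f (cutoffFun r) (star x * x)
    (hφ := map_continuous f) (hφa := hs.map f), map_mul, map_star]

omit [PartialOrder E] [StarOrderedRing E] in
theorem continuous_cfcₙ_of_isSelfAdjoint {X : Type*} [TopologicalSpace X] {f : ℝ → ℝ} (hf : Continuous f)
    (hf0 : f 0 = 0) {a : X → E} (ha : Continuous a) (has : ∀ x, IsSelfAdjoint (a x)) :
    Continuous fun x => cfcₙ f (a x) :=
  Continuous.cfcₙ_of_mem_nhdsSet (s := Set.univ) f Filter.univ_mem ha has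

omit [PartialOrder E] [StarOrderedRing E] in
theorem continuous_cutoff (r : ℝ) : Continuous (cutoff r : E → E) := by
  unfold cutoff
  split_ifs with h
  swap; · exact continuous_const
  refine continuous_id.sub (continuous_id.mul ?_)
  exact continuous_cfcₙ_of_isSelfAdjoint (continuous_cutoffFun h)
    (cutoffFun_of_le h (by positivity)) (by fun_prop) fun x => IsSelfAdjoint.star_mul_self x

theorem cutoff_nonneg (r : ℝ) {x : E} (hx : 0 ≤ x) : 0 ≤ cutoff r x := by
  unfold cutoff
  split_ifs with h
  swap; · exact le_rfl
  have hxs : IsSelfAdjoint x := hx.isSelfAdjoint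
  have hc := continuous_cutoffFun h
  have h0 : cutoffFun r 0 = 0 := cutoffFun_of_le h (by positivity)
  have e1 : star x * x = cfcₙ (fun s : ℝ => s * s) x := by
    rw [cfcₙ_mul (fun s : ℝ => s) (fun s => s) x, cfcₙ_id' ℝ x, hxs.star_eq]
  have e2 : cfcₙ (cutoffFun r) (star x * x) = cfcₙ (fun s : ℝ => cutoffFun r (s * s)) x := by
    rw [e1, ← cfcₙ_comp' (cutoffFun r) (fun s : ℝ => s * s) x hc.continuousOn h0]
  have e3 : x - x * cfcₙ (cutoffFun r) (star x * x)
      = cfcₙ (fun s : ℝ => s - s * cutoffFun r (s * s)) x := by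
    have h0' : cutoffFun r (0 * 0) = 0 := by simpa using h0
    rw [cfcₙ_sub (fun s : ℝ => s) (fun s => s * cutoffFun r (s * s)) x,
      cfcₙ_mul (fun s : ℝ => s) (fun s => cutoffFun r (s * s)) x (hg0 := h0'), cfcₙ_id' ℝ x, e2]
  rw [e3]
  refine cfcₙ_nonneg fun s hs => ?_
  have hs0 : 0 ≤ s := quasispectrum_nonneg_of_nonneg _ hx s hs
  have : cutoffFun r (s * s) ≤ 1 := by
    unfold cutoffFun
    have : 0 ≤ r / √(max (s * s) (r ^ 2)) := by positivity
    linarith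
  nlinarith

/-- Elements of a quotient C⋆-algebra lift without increasing the norm. -/
theorem exists_lift_norm_le {F : Type*} [NonUnitalCStarAlgebra F] [PartialOrder F]
    [StarOrderedRing F] (f : E →⋆ₙₐ[ℂ] F) (hf : Function.Surjective f) (y : F) :
    ∃ x, f x = y ∧ ‖x‖ ≤ ‖y‖ := by
  obtain ⟨x, rfl⟩ := hf y
  exact ⟨cutoff ‖f x‖ x, by rw [map_cutoff, cutoff_of_norm_le (norm_nonneg _) le_rfl],
    norm_cutoff_le (norm_nonneg _) _⟩

/-- What the cutoff at level `‖f x‖` removes from `x` is killed by `f`, because `f x` is fixed by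
that cutoff. -/
theorem exists_map_eq_zero_norm_sub_le {F : Type*} [NonUnitalCStarAlgebra F] [PartialOrder F]
    [StarOrderedRing F] (f : E →⋆ₙₐ[ℂ] F) (x : E) :
    ∃ c, f c = 0 ∧ ‖x - c‖ ≤ ‖f x‖ :=
  ⟨x - cutoff ‖f x‖ x, by rw [map_sub, map_cutoff, cutoff_of_norm_le (norm_nonneg _) le_rfl,
    sub_self], by rw [sub_sub_cancel]; exact norm_cutoff_le (norm_nonneg _) _⟩

omit [PartialOrder E] [StarOrderedRing E] in
theorem map_posPart {F : Type*} [NonUnitalCStarAlgebra F]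
    (f : E →⋆ₙₐ[ℂ] F) {x : E} (hx : IsSelfAdjoint x) : f x⁺ = (f x)⁺ := by
  rw [CFC.posPart_def, CFC.posPart_def, NonUnitalStarAlgHom.map_cfcₙ f _ x (hφ := map_continuous f)]

omit [PartialOrder E] [StarOrderedRing E] in
theorem map_negPart {F : Type*} [NonUnitalCStarAlgebra F]
    (f : E →⋆ₙₐ[ℂ] F) {x : E} (hx : IsSelfAdjoint x) : f x⁻ = (f x)⁻ := by
  rw [CFC.negPart_def, CFC.negPart_def, NonUnitalStarAlgHom.map_cfcₙ f _ x (hφ := map_continuous f)]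

end Cutoff

/-! ### A Hahn–Banach criterion for elements of small norm. -/

section Separation

variable {D : Type*} [NonUnitalNormedRing D] [StarRing D] [CStarRing D] [NormedSpace ℝ D]

omit [NormedSpace ℝ D] in
theorem norm_add_sq_le_of_star_mul (x y : D) :
    ‖x + y‖ ^ 2 ≤ ‖x‖ ^ 2 + ‖y‖ ^ 2 + 2 * ‖star x * y‖ := by
  have h : ‖star y * x‖ = ‖star x * y‖ := by rw [← norm_star, star_mul, star_star]
  calc ‖x + y‖ ^ 2 = ‖star x * x + star y * y + (star x * y + star y * x)‖ := by
        rw [sq, ← CStarRing.norm_star_mul_self, star_add]; congr 1; noncomm_ring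
    _ ≤ ‖star x * x‖ + ‖star y * y‖ + (‖star x * y‖ + ‖star y * x‖) :=
        (norm_add_le _ _).trans (add_le_add (norm_add_le _ _) (norm_add_le _ _))
    _ = _ := by rw [CStarRing.norm_star_mul_self, CStarRing.norm_star_mul_self, h]; ring

/-- A bounded functional on a C⋆-algebra is small on elements almost orthogonal to an element at
which it almost attains its norm. -/
theorem exists_forall_star_mul_le_imp_apply_le [IsScalarTower ℝ D D] [SMulCommClass ℝ D D]
    (S : Submodule ℝ D) (F : D →L[ℝ] ℝ) (M : ℝ) {ε : ℝ} (hε : 0 < ε) :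
    ∃ x ∈ S, ∃ δ > 0, ∀ y ∈ S, ‖y‖ ≤ M → ‖star x * y‖ ≤ δ → F y ≤ ε := by
  set N : ℝ := ‖F.comp S.subtypeL‖ with hN
  have hN0 : 0 ≤ N := (F.comp S.subtypeL).opNorm_nonneg
  have hFN : ∀ z ∈ S, F z ≤ N * ‖z‖ := fun z hz =>
    (le_abs_self _).trans ((F.comp S.subtypeL).le_opNorm ⟨z, hz⟩)
  -- A near-maximiser `x` of `F` is perturbed to `x + s • y`. The value grows by `s * F y`, the norm
  -- only by about `s ^ 2 * M ^ 2 / 2 + s * δ`. This `s` makes the second-order cost at most `s * ε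
  -- / 2`; the defect of `x` and the `δ` term cost `s * ε / 4` each.
  set s : ℝ := ε / ((N + 1) * (M ^ 2 + 1)) with hs
  have hs0 : 0 < s := by positivity
  obtain ⟨x, hxS, hx1, hx⟩ : ∃ x ∈ S, ‖x‖ ≤ 1 ∧ N - s * ε / 4 ≤ F x := by
    have hlt : N - s * ε / 4 < ‖F.comp S.subtypeL‖ := by
      have : 0 < s * ε / 4 := by positivity
      linarith
    rcases lt_or_ge (N - s * ε / 4) 0 with h | h
    · exact ⟨0, S.zero_mem, by simp, by simpa using h.le⟩
    obtain ⟨z, hz1, hz2⟩ := (F.comp S.subtypeL).exists_lt_apply_of_lt_opNorm hlt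
    rcases le_total 0 (F z) with h0 | h0
    · exact ⟨z, z.2, hz1.le, by
        have : ‖(F.comp S.subtypeL) z‖ = F z := Real.norm_of_nonneg h0
        rw [this] at hz2; exact hz2.le⟩
    · refine ⟨-z, S.neg_mem z.2, by simpa using hz1.le, ?_⟩
      have : ‖(F.comp S.subtypeL) z‖ = -F z := Real.norm_of_nonpos h0
      rw [this] at hz2; simpa using hz2.le
  refine ⟨x, hxS, ε / (4 * (N + 1)), by positivity, fun y hy hyM hxy => ?_⟩
  have h1 : F (x + s • y) = F x + s * F y := by simp
  have h2 := hFN (x + s • y) (S.add_mem hxS (S.smul_mem s hy))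
  set δ := ε / (4 * (N + 1)) with hδ
  have h3 : ‖x + s • y‖ ≤ 1 + (s ^ 2 * M ^ 2 + 2 * s * δ) / 2 := by
    have h4 := norm_add_sq_le_of_star_mul x (s • y)
    rw [mul_smul_comm, norm_smul, norm_smul, Real.norm_of_nonneg hs0.le] at h4
    have h5 : (s * ‖y‖) ^ 2 ≤ s ^ 2 * M ^ 2 := by
      rw [mul_pow]; gcongr
    have h6 : ‖x‖ ^ 2 ≤ 1 := pow_le_one₀ (norm_nonneg _) hx1
    have h7 : s * ‖star x * y‖ ≤ s * δ := by gcongr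
    have hδ0 : 0 < δ := by positivity
    set q := s ^ 2 * M ^ 2 + 2 * s * δ
    have hq : 0 ≤ q := by positivity
    have h8 : ‖x + s • y‖ ^ 2 ≤ 1 + q := by simp only [q]; linarith
    nlinarith [norm_nonneg (x + s • y), sq_nonneg q]
  have h9 : s * F y ≤ s * ε / 4 + N * ((s ^ 2 * M ^ 2 + 2 * s * δ) / 2) := by
    have := mul_le_mul_of_nonneg_left h3 hN0
    linarith
  have h10 : N * (s * M ^ 2) ≤ ε := by
    have : s * ((N + 1) * (M ^ 2 + 1)) = ε := by rw [hs]; field_simp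
    nlinarith [mul_nonneg hs0.le hN0, mul_nonneg hs0.le (sq_nonneg M)]
  have h11 : N * δ ≤ ε / 4 := by
    have : δ * (4 * (N + 1)) = ε := by rw [hδ]; field_simp
    have : 0 < δ := by positivity
    linarith
  have h12 : s * F y ≤ s * ε := by
    have : N * ((s ^ 2 * M ^ 2 + 2 * s * δ) / 2) = s * (N * (s * M ^ 2) / 2 + N * δ) := by ring
    rw [this] at h9
    have : s * (N * (s * M ^ 2) / 2 + N * δ) ≤ s * (ε / 2 + ε / 4) := by gcongr
    linarith
  exact le_of_mul_le_mul_left h12 hs0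

/-- If a bounded convex set of elements of a subspace `S` of a C⋆-algebra contains elements almost
orthogonal to any given element of `S`, then it contains elements of arbitrarily small norm. -/
theorem exists_norm_lt_of_forall_star_mul_le [IsScalarTower ℝ D D] [SMulCommClass ℝ D D]
    {V : Type*} [AddCommGroup V] [Module ℝ V] (S : Submodule ℝ D) (T : V →ₗ[ℝ] D) {s : Set V}
    (hs : Convex ℝ s) {M : ℝ} (hM : ∀ e ∈ s, ‖T e‖ ≤ M) (hS : ∀ e ∈ s, T e ∈ S)
    (h : ∀ x ∈ S, ∀ δ > 0, ∃ e ∈ s, ‖star x * T e‖ ≤ δ) {ε : ℝ} (hε : 0 < ε) :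
    ∃ e ∈ s, ‖T e‖ < ε := by
  suffices h0 : (0 : D) ∈ closure (T '' s) by
    obtain ⟨_, ⟨e, he, rfl⟩, h1⟩ := Metric.mem_closure_iff.mp h0 ε hε
    exact ⟨e, he, by simpa [dist_eq_norm] using h1⟩
  by_contra hc
  -- A functional exceeding some `r > 0` on all of `T '' s` cannot exist, since it is at most `r` on
  -- elements almost orthogonal to a near-maximiser.
  obtain ⟨F, r, hr, hF⟩ := geometric_hahn_banach_point_closed (hs.linear_image T).closure
    isClosed_closure hc
  rw [map_zero] at hr
  obtain ⟨x, hxS, δ, hδ, hx⟩ := exists_forall_star_mul_le_imp_apply_le S F M hr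
  obtain ⟨e, he, hxe⟩ := h x hxS δ hδ
  exact absurd (hx _ (hS e he) (hM e he) hxe)
    (not_le.mpr (hF _ (subset_closure ⟨e, he, rfl⟩)))

end Separation

/-! ### Isometry and joint continuity of the action. -/

section Action

variable {G B : Type*} [Group G] [TopologicalSpace G] [NonUnitalCStarAlgebra B]

omit [TopologicalSpace G] in
theorem norm_action (β : G →* (B ≃⋆ₐ[ℂ] B)) (g : G) (b : B) : ‖β g b‖ = ‖b‖ :=
  StarAlgEquiv.norm_map (β g) b

theorem IsContinuousAction.continuous_uncurry {β : G →* (B ≃⋆ₐ[ℂ] B)} (hβ : IsContinuousAction β) :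
    Continuous fun p : G × B => β p.1 p.2 := by
  refine continuous_iff_continuousAt.mpr fun ⟨g, b⟩ => ?_
  refine tendsto_iff_norm_sub_tendsto_zero.mpr ?_
  have h1 : Tendsto (fun p : G × B => ‖p.2 - b‖ + ‖β p.1 b - β g b‖) (𝓝 (g, b)) (𝓝 0) := by
    have hc : Continuous fun p : G × B => ‖p.2 - b‖ + ‖β p.1 b - β g b‖ := by
      have h := (hβ b).comp (continuous_fst (X := G) (Y := B))
      exact (continuous_snd.sub continuous_const).norm.add (h.sub continuous_const).norm
    simpa using hc.tendsto (g, b)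
  refine squeeze_zero (fun _ => norm_nonneg _) (fun p => ?_) h1
  calc ‖β p.1 p.2 - β g b‖ = ‖β p.1 (p.2 - b) + (β p.1 b - β g b)‖ := by
        rw [map_sub]; congr 1; abel
    _ ≤ _ := (norm_add_le _ _).trans (by rw [norm_action])

end Action

/-! ### Quasicentral, almost invariant approximate units. -/

section Quasicentral

variable {B Q : Type*} [NonUnitalCStarAlgebra B] [PartialOrder B] [StarOrderedRing B]
  [NonUnitalCStarAlgebra Q]

/-- Take `e = h / (h + ε ^ 2)` with `h = ∑ star c * c`. Then `‖c - c * e‖ ^ 2` is at most the norm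
of `(1 - e) h (1 - e) = ε ^ 4 * h / (h + ε ^ 2) ^ 2`, hence at most `ε ^ 2`. -/
theorem exists_approximate_unit_finset (π : B →⋆ₙₐ[ℂ] Q) (s : Finset B) (hs : ∀ c ∈ s, π c = 0)
    {ε : ℝ} (hε : 0 < ε) :
    ∃ e : B, 0 ≤ e ∧ ‖e‖ ≤ 1 ∧ π e = 0 ∧ ∀ c ∈ s, ‖c - c * e‖ ≤ ε := by
  set h : B := ∑ c ∈ s, star c * c with hh
  have hh0 : 0 ≤ h := Finset.sum_nonneg fun c _ => star_mul_self_nonneg c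
  have hπh : π h = 0 := by
    rw [hh, map_sum]
    exact Finset.sum_eq_zero fun c hc => by rw [map_mul, hs c hc, mul_zero]
  set f : ℝ → ℝ := fun t => |t| / (|t| + ε ^ 2) with hf
  have hpos : ∀ t : ℝ, 0 < |t| + ε ^ 2 := fun t => by positivity
  have hfc : Continuous f := by
    refine Continuous.div (by fun_prop) (by fun_prop) fun t => (hpos t).ne'
  have hf0 : f 0 = 0 := by simp [hf]
  have hfnn : ∀ t, 0 ≤ f t := fun t => by positivity
  have hf1 : ∀ t, f t ≤ 1 := fun t => by
    rw [hf, div_le_one (hpos t)]; nlinarith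
  set e := cfcₙ f h with he
  have he0 : 0 ≤ e := cfcₙ_nonneg fun t _ => hfnn t
  have he1 : ‖e‖ ≤ 1 := norm_cfcₙ_le fun t _ => by
    rw [Real.norm_of_nonneg (hfnn t)]; exact hf1 t
  refine ⟨e, he0, he1, ?_, fun c hc => ?_⟩
  · rw [he, NonUnitalStarAlgHom.map_cfcₙ π f h (hφ := map_continuous π)
      (hφa := hh0.isSelfAdjoint.map π), hπh, cfcₙ_apply_zero]
  · refine (sq_le_sq₀ (norm_nonneg _) hε.le).mp ?_
    have e1 : star (c - c * e) * (c - c * e) = compress e (star c * c) := by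
      rw [star_sub, star_mul, he0.isSelfAdjoint.star_eq, compress]; noncomm_ring
    rw [sq, ← CStarRing.norm_star_mul_self, e1]
    have h1 : compress e (star c * c) ≤ compress e h := by
      rw [← sub_nonneg, ← compress_sub]
      refine compress_nonneg he0.isSelfAdjoint (sub_nonneg.mpr ?_)
      exact Finset.single_le_sum (f := fun c : B => star c * c)
        (fun c _ => star_mul_self_nonneg c) hc
    refine (CStarAlgebra.norm_le_norm_of_nonneg_of_le
      (compress_nonneg he0.isSelfAdjoint (star_mul_self_nonneg c)) h1).trans ?_
    rw [he, compress_cfcₙ hfc hf0 hh0.isSelfAdjoint]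
    refine norm_cfcₙ_le fun t ht => ?_
    have ht0 : 0 ≤ t := quasispectrum_nonneg_of_nonneg _ hh0 t ht
    have e2 : (t - f t * t) - (t - f t * t) * f t = t * (ε ^ 2 / (t + ε ^ 2)) ^ 2 := by
      have : t + ε ^ 2 ≠ 0 := by positivity
      simp only [hf, abs_of_nonneg ht0]
      field_simp
      ring
    rw [e2, Real.norm_of_nonneg (by positivity), div_pow, mul_div_assoc', div_le_iff₀ (by positivity)]
    nlinarith [mul_nonneg ht0 (sq_nonneg ε), mul_nonneg (sq_nonneg ε) (sq_nonneg t),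
      mul_nonneg (sq_nonneg ε) (sq_nonneg (ε ^ 2)), mul_nonneg (mul_nonneg ht0 (sq_nonneg ε)) (sq_nonneg ε)]

theorem exists_approximate_unit_isCompact (π : B →⋆ₙₐ[ℂ] Q) {C : Set B} (hC : IsCompact C)
    (hCπ : ∀ c ∈ C, π c = 0) {ε : ℝ} (hε : 0 < ε) :
    ∃ e : B, 0 ≤ e ∧ ‖e‖ ≤ 1 ∧ π e = 0 ∧ ∀ c ∈ C, ‖c - c * e‖ ≤ ε := by
  obtain ⟨t, htC, htf, ht⟩ := hC.finite_cover_balls (half_pos hε)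
  obtain ⟨e, he0, he1, heπ, he⟩ := exists_approximate_unit_finset π htf.toFinset
    (fun c hc => hCπ c (htC (htf.mem_toFinset.mp hc))) (half_pos hε)
  refine ⟨e, he0, he1, heπ, fun c hc => ?_⟩
  obtain ⟨d, hd, hcd⟩ := Set.mem_iUnion₂.mp (ht hc)
  have h1 := he d (htf.mem_toFinset.mpr hd)
  have h2 := norm_sub_right_mul_le he0 he1 (c - d)
  rw [Metric.mem_ball, dist_eq_norm] at hcd
  calc ‖c - c * e‖ = ‖((c - d) - (c - d) * e) + (d - d * e)‖ := by
        rw [sub_mul]; congr 1; abel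
    _ ≤ ‖c - d‖ + ε / 2 := (norm_add_le _ _).trans (add_le_add h2 h1)
    _ ≤ ε := by linarith

variable {G : Type*} [Group G] [TopologicalSpace G] [IsTopologicalGroup G]

/-- The linear map recording commutators with elements of `L` and displacements under elements
of `K`. -/
def displacement {β : G →* (B ≃⋆ₐ[ℂ] B)} (hβ : IsContinuousAction β) (K : Set G) (L : Set B) :
    B →ₗ[ℝ] C(K, B) × C(L, B) where
  toFun e := (⟨fun g => β g e - e, ((hβ e).comp continuous_subtype_val).sub continuous_const⟩,
    ⟨fun x => e * x - x * e, by fun_prop⟩)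
  map_add' a b := by
    ext x
    · simp; abel
    · simp [add_mul, mul_add]; abel
  map_smul' r a := by
    ext x
    · have : β x (r • a) = r • β x a := map_real_smul (β x) (map_continuous (β x)) r a
      simp [smul_sub, this]
    · simp [smul_sub, smul_mul_assoc, mul_smul_comm]

/-- Compact sets admit quasicentral, almost invariant approximate units for an invariant ideal. -/
theorem exists_quasicentral_invariant {β : G →* (B ≃⋆ₐ[ℂ] B)} (hβ : IsContinuousAction β)
    (π : B →⋆ₙₐ[ℂ] Q) (hπβ : ∀ g b, π b = 0 → π (β g b) = 0)
    {K : Set G} (hK : IsCompact K) {L : Set B} (hL : IsCompact L) {C : Set B} (hC : IsCompact C)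
    (hCπ : ∀ c ∈ C, π c = 0) {ε : ℝ} (hε : 0 < ε) :
    ∃ e : B, 0 ≤ e ∧ ‖e‖ ≤ 1 ∧ π e = 0 ∧ (∀ c ∈ C, ‖c - c * e‖ ≤ ε) ∧
      (∀ x ∈ L, ‖e * x - x * e‖ ≤ ε) ∧ ∀ g ∈ K, ‖β g e - e‖ ≤ ε := by
  have : CompactSpace K := isCompact_iff_compactSpace.mp hK
  have : CompactSpace L := isCompact_iff_compactSpace.mp hL
  obtain ⟨R, hR⟩ := hL.isBounded.exists_norm_le
  have hR' : ∀ x ∈ L, ‖x‖ ≤ |R| := fun x hx => (hR x hx).trans (le_abs_self R)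
  set s : Set B := {e | 0 ≤ e ∧ ‖e‖ ≤ 1 ∧ π e = 0 ∧ ∀ c ∈ C, ‖c - c * e‖ ≤ ε} with hs
  set T := displacement hβ K L with hT
  -- Test functions are restricted to values in `ker π`, since only there does `e` act as an
  -- approximate unit. `T` maps `s` into this subspace.
  let S : Submodule ℝ (C(K, B) × C(L, B)) :=
    { carrier := {p | (∀ g, π (p.1 g) = 0) ∧ ∀ x, π (p.2 x) = 0}
      add_mem' := fun {a b} ha hb => ⟨fun g => by simp [ha.1 g, hb.1 g],
        fun x => by simp [ha.2 x, hb.2 x]⟩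
      zero_mem' := ⟨fun g => by simp, fun x => by simp⟩
      smul_mem' := fun r a ha => ⟨fun g => by
          have : π (r • a.1 g) = r • π (a.1 g) := map_real_smul π (map_continuous π) r _
          simp [this, ha.1 g],
        fun x => by
          have : π (r • a.2 x) = r • π (a.2 x) := map_real_smul π (map_continuous π) r _
          simp [this, ha.2 x]⟩ }
  have hconv : Convex ℝ s := by
    intro e he e' he' a b ha hb hab
    refine ⟨add_nonneg (smul_nonneg ha he.1) (smul_nonneg hb he'.1), ?_, ?_, fun c hc => ?_⟩
    · have := (convex_closedBall (0 : B) 1) (mem_closedBall_zero_iff.mpr he.2.1)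
        (mem_closedBall_zero_iff.mpr he'.2.1) ha hb hab
      exact mem_closedBall_zero_iff.mp this
    · have h1 : π (a • e) = a • π e := map_real_smul π (map_continuous π) a e
      have h2 : π (b • e') = b • π e' := map_real_smul π (map_continuous π) b e'
      rw [map_add, h1, h2, he.2.2.1, he'.2.2.1]; simp
    · have : c - c * (a • e + b • e') = a • (c - c * e) + b • (c - c * e') := by
        have h1 : c = a • c + b • c := by rw [← add_smul, hab, one_smul]
        rw [mul_add, mul_smul_comm, mul_smul_comm, smul_sub, smul_sub]
        nth_rw 1 [h1]; abel
      rw [this]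
      have := (convex_closedBall (0 : B) ε) (mem_closedBall_zero_iff.mpr (he.2.2.2 c hc))
        (mem_closedBall_zero_iff.mpr (he'.2.2.2 c hc)) ha hb hab
      exact mem_closedBall_zero_iff.mp this
  have hbound : ∀ e ∈ s, ‖T e‖ ≤ 2 + 2 * |R| := by
    intro e he
    refine norm_prod_le_iff.mpr ⟨?_, ?_⟩
    · refine (ContinuousMap.norm_le _ (by positivity)).mpr fun g => ?_
      have h1 : ‖β g e - e‖ ≤ 1 + 1 :=
        (norm_sub_le _ _).trans (add_le_add ((norm_action β g e).trans_le he.2.1) he.2.1)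
      have : 0 ≤ |R| := abs_nonneg R
      exact h1.trans (by linarith)
    · refine (ContinuousMap.norm_le _ (by positivity)).mpr fun x => ?_
      have hx := hR' x x.2
      have h1 : ‖e * x‖ ≤ 1 * |R| := (norm_mul_le _ _).trans
        (mul_le_mul he.2.1 hx (norm_nonneg _) zero_le_one)
      have h2 : ‖(x : B) * e‖ ≤ |R| * 1 := (norm_mul_le _ _).trans
        (mul_le_mul hx he.2.1 (norm_nonneg _) (abs_nonneg R))
      have h3 : ‖e * x - x * e‖ ≤ 1 * |R| + |R| * 1 := (norm_sub_le _ _).trans (add_le_add h1 h2)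
      exact h3.trans (by linarith)
  have hmem : ∀ e ∈ s, T e ∈ S := fun e he => by
    refine ⟨fun g => ?_, fun x => ?_⟩
    · change π (β g e - e) = 0
      rw [map_sub, hπβ _ _ he.2.2.1, he.2.2.1, sub_zero]
    · change π (e * x - x * e) = 0
      rw [map_sub, map_mul, map_mul, he.2.2.1, zero_mul, mul_zero, sub_zero]
  have key : ∀ p ∈ S, ∀ δ > 0, ∃ e ∈ s, ‖star p * T e‖ ≤ δ := by
    rintro ⟨p, q⟩ ⟨hp, hq⟩ δ hδ
    -- Since `star (p g) * β g e = β g (w g * e)`, approximate-unit estimates for `w g` and for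
    -- `star (p g)` together control the displacement term.
    let w : C(K, B) := ⟨fun g => β (g : G)⁻¹ (star (p g)), hβ.continuous_uncurry.comp
      (by fun_prop : Continuous fun g : K => ((g : G)⁻¹, star (p g)))⟩
    let C' : Set B := C ∪ (Set.range w ∪ Set.range (star p)) ∪
      (Set.range (star q) ∪ Set.range fun x : L => star (q x) * (x : B))
    have hC' : IsCompact C' :=
      (hC.union ((isCompact_range w.continuous).union (isCompact_range (star p).continuous))).union
        ((isCompact_range (star q).continuous).union (isCompact_range (by fun_prop)))
    have hC'π : ∀ c ∈ C', π c = 0 := by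
      rintro c ((hc | ⟨g, rfl⟩ | ⟨g, rfl⟩) | ⟨x, rfl⟩ | ⟨x, rfl⟩)
      · exact hCπ c hc
      · exact hπβ _ _ (by rw [map_star]; simpa using hp g)
      · change π (star (p g)) = 0
        rw [map_star]; simpa using hp g
      · change π (star (q x)) = 0
        rw [map_star]; simpa using hq x
      · change π (star (q x) * x) = 0
        rw [map_mul, map_star]
        have : π (q x) = 0 := hq x
        simp [this]
    set η := min ε (δ / (2 + |R|)) with hη
    have hη0 : 0 < η := lt_min hε (by positivity)
    have hηδ : η * (2 + |R|) ≤ δ := (le_div_iff₀ (by positivity)).mp (min_le_right _ _)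
    have hR0 : 0 ≤ |R| := abs_nonneg R
    obtain ⟨e, he0, he1, heπ, he⟩ := exists_approximate_unit_isCompact π hC' hC'π hη0
    refine ⟨e, ⟨he0, he1, heπ, fun c hc => (he c (.inl (.inl hc))).trans (min_le_left _ _)⟩, ?_⟩
    refine norm_prod_le_iff.mpr ⟨?_, ?_⟩
    · refine (ContinuousMap.norm_le _ hδ.le).mpr fun g => ?_
      change ‖star (p g) * (β g e - e)‖ ≤ δ
      have h1 : ‖w g - w g * e‖ ≤ η := he _ (.inl (.inr (.inl ⟨g, rfl⟩)))
      have h2 : ‖star (p g) - star (p g) * e‖ ≤ η := he _ (.inl (.inr (.inr ⟨g, rfl⟩)))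
      have e1 : β g (w g) = star (p g) := by
        change β g (β (g : G)⁻¹ (star (p g))) = _
        rw [← StarAlgEquiv.mul_apply, ← map_mul]; simp
      have e2 : star (p g) * (β g e - e)
          = (star (p g) - star (p g) * e) - β g (w g - w g * e) := by
        rw [map_sub, map_mul, e1, mul_sub]; abel
      rw [e2]
      refine (norm_sub_le _ _).trans ?_
      rw [norm_action]
      nlinarith
    · refine (ContinuousMap.norm_le _ hδ.le).mpr fun x => ?_
      change ‖star (q x) * (e * x - x * e)‖ ≤ δ
      have h1 : ‖star (q x) - star (q x) * e‖ ≤ η := he _ (.inr (.inl ⟨x, rfl⟩))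
      have h2 : ‖star (q x) * x - star (q x) * x * e‖ ≤ η := he _ (.inr (.inr ⟨x, rfl⟩))
      have e2 : star (q x) * (e * x - x * e)
          = (star (q x) * x - star (q x) * x * e) - (star (q x) - star (q x) * e) * x := by
        noncomm_ring
      rw [e2]
      have h3 : ‖(star (q x) - star (q x) * e) * x‖ ≤ η * |R| :=
        (norm_mul_le _ _).trans (mul_le_mul h1 (hR' x x.2) (norm_nonneg _) hη0.le)
      refine (norm_sub_le _ _).trans ?_
      nlinarith
  obtain ⟨e, he, hTe⟩ := exists_norm_lt_of_forall_star_mul_le S T hconv hbound hmem key hε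
  refine ⟨e, he.1, he.2.1, he.2.2.1, he.2.2.2, fun x hx => ?_, fun g hg => ?_⟩
  · exact (ContinuousMap.norm_coe_le_norm (T e).2 ⟨x, hx⟩).trans
      ((norm_snd_le (T e)).trans hTe.le)
  · exact (ContinuousMap.norm_coe_le_norm (T e).1 ⟨g, hg⟩).trans
      ((norm_fst_le (T e)).trans hTe.le)

end Quasicentral

/-! ### Piecewise linear interpolation of sequences. -/

section Interpolation

variable {V : Type*} [AddCommGroup V] [Module ℝ V]

/-- The interpolation weight of `t` between `⌊t⌋₊` and `⌊t⌋₊ + 1`. -/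
noncomputable def interpWeight (t : ℝ) : ℝ := max 0 (t - ⌊t⌋₊)

theorem interpWeight_nonneg (t : ℝ) : 0 ≤ interpWeight t := le_max_left _ _

theorem interpWeight_le_one (t : ℝ) : interpWeight t ≤ 1 :=
  max_le zero_le_one (by linarith [Nat.lt_floor_add_one t])

/-- Linear interpolation of a sequence of paths. -/
noncomputable def interp (F : ℕ → ℝ → V) (t : ℝ) : V :=
  (1 - interpWeight t) • F ⌊t⌋₊ t + interpWeight t • F (⌊t⌋₊ + 1) t

theorem Convex.interp_mem {s : Set V} (hs : Convex ℝ s) {F : ℕ → ℝ → V} {t : ℝ}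
    (h0 : F ⌊t⌋₊ t ∈ s) (h1 : F (⌊t⌋₊ + 1) t ∈ s) : interp F t ∈ s :=
  hs h0 h1 (sub_nonneg.mpr (interpWeight_le_one t)) (interpWeight_nonneg t) (by ring)

theorem continuous_interp [TopologicalSpace V] [ContinuousAdd V] [ContinuousSMul ℝ V]
    {F : ℕ → ℝ → V} (hF : ∀ n, Continuous (F n)) : Continuous (interp F) := by
  -- A locally finite closed cover; the first piece extends to `-∞`, where `⌊t⌋₊ = 0` and the weight
  -- is `0`.
  let s : ℕ → Set ℝ := fun n => {t | t ≤ n + 1 ∧ (n = 0 ∨ (n : ℝ) ≤ t)}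
  refine LocallyFinite.continuous (f := s) (fun t => ?_) ?_ (fun n => ?_) fun n => ?_
  · refine ⟨Set.Iio (t + 1), Iio_mem_nhds (by linarith), (Set.finite_Iic ⌊t + 1⌋₊).subset ?_⟩
    rintro n ⟨x, ⟨-, h⟩, hx⟩
    rcases h with rfl | h
    · simp
    · exact Nat.le_floor (h.trans (le_of_lt hx))
  · refine Set.eq_univ_of_forall fun t => Set.mem_iUnion.mpr ⟨⌊t⌋₊, (Nat.lt_floor_add_one t).le, ?_⟩
    rcases le_total 0 t with h | h
    · exact .inr (Nat.floor_le h)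
    · exact .inl (Nat.floor_of_nonpos h)
  · rcases eq_or_ne n 0 with rfl | hn
    · simpa [s, Set.Iic] using isClosed_Iic (a := (1 : ℝ))
    · simpa [s, hn, Set.Icc, and_comm] using isClosed_Icc (a := (n : ℝ)) (b := n + 1)
  · have hc : Continuous fun t : ℝ =>
        (1 - max 0 (t - n)) • F n t + max 0 (t - n) • F (n + 1) t := by
      have h1 := hF n
      have h2 := hF (n + 1)
      fun_prop
    refine hc.continuousOn.congr fun t ht => ?_
    rcases ht.1.eq_or_lt with h | h
    · have hfl : ⌊t⌋₊ = n + 1 := by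
        rw [h]; exact_mod_cast Nat.floor_natCast (R := ℝ) (n + 1)
      have hw : interpWeight t = 0 := by rw [interpWeight, hfl, h]; simp
      have hw' : max 0 (t - n) = 1 := by rw [h]; simp
      simp only [interp, hw, hw', hfl]; simp
    · have hfl : ⌊t⌋₊ = n := by
        rcases ht.2 with h0 | h0
        · subst h0
          exact Nat.floor_eq_zero.mpr (by simpa using h)
        · exact (Nat.floor_eq_iff ((Nat.cast_nonneg n).trans h0)).mpr ⟨h0, h⟩
      simp only [interp, interpWeight, hfl]

theorem norm_add_map_interp_le {W : Type*} [SeminormedAddCommGroup W] [NormedSpace ℝ W]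
    (T : V →ₗ[ℝ] W) (y : W) {r t : ℝ} {e : ℕ → V} (h0 : ‖y + T (e ⌊t⌋₊)‖ ≤ r)
    (h1 : ‖y + T (e (⌊t⌋₊ + 1))‖ ≤ r) : ‖y + T (interp (fun n _ => e n) t)‖ ≤ r := by
  have hc : Convex ℝ {x | ‖y + T x‖ ≤ r} := by
    have := (convex_closedBall (0 : W) r).affine_preimage
      ((AffineMap.const ℝ V y) + T.toAffineMap)
    simpa [Set.preimage] using this
  exact hc.interp_mem (F := fun n _ => e n) (t := t) h0 h1

end Interpolation

/-! ### A continuous path of quasicentral elements. -/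

section Path

variable {B Q : Type*} [NonUnitalCStarAlgebra B] [PartialOrder B] [StarOrderedRing B]
  [NonUnitalCStarAlgebra Q] [PartialOrder Q] [StarOrderedRing Q]
  {G : Type*} [Group G] [TopologicalSpace G] [IsTopologicalGroup G]

/-- Each `x` is within `‖π x‖` of some `c` in the kernel, and `e` almost fixes `c` under right
multiplication. As `c` need not depend continuously on `x`, it is chosen only on a finite net of
`L`. -/
theorem exists_quasicentral_norm_sub_mul_le {β : G →* (B ≃⋆ₐ[ℂ] B)} (hβ : IsContinuousAction β)
    (π : B →⋆ₙₐ[ℂ] Q) (hπβ : ∀ g b, π b = 0 → π (β g b) = 0)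
    {K : Set G} (hK : IsCompact K) {L : Set B} (hL : IsCompact L) {ε : ℝ} (hε : 0 < ε) :
    ∃ e : B, 0 ≤ e ∧ ‖e‖ ≤ 1 ∧ π e = 0 ∧ (∀ x ∈ L, ‖x - x * e‖ ≤ ‖π x‖ + ε) ∧
      (∀ x ∈ L, ‖e * x - x * e‖ ≤ ε) ∧ ∀ g ∈ K, ‖β g e - e‖ ≤ ε := by
  have hε3 : 0 < ε / 3 := by positivity
  obtain ⟨t, -, htf, ht⟩ := hL.finite_cover_balls hε3
  choose c hcπ hc using fun x : B => exists_map_eq_zero_norm_sub_le π x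
  obtain ⟨e, he0, he1, heπ, heC, heL, heK⟩ := exists_quasicentral_invariant hβ π hπβ hK hL
    (htf.image c).isCompact (by rintro _ ⟨x, -, rfl⟩; exact hcπ x) hε3
  refine ⟨e, he0, he1, heπ, fun x hx => ?_, fun x hx => (heL x hx).trans (by linarith),
    fun g hg => (heK g hg).trans (by linarith)⟩
  obtain ⟨d, hd, hxd⟩ := Set.mem_iUnion₂.mp (ht hx)
  rw [Metric.mem_ball, dist_eq_norm] at hxd
  have h1 := norm_sub_right_mul_le he0 he1 (x - c d)
  have h2 := heC _ ⟨d, hd, rfl⟩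
  have h3 : ‖x - c d‖ ≤ ‖x - d‖ + ‖d - c d‖ := norm_sub_le_norm_sub_add_norm_sub _ _ _
  have h4 : ‖π d‖ ≤ ‖π x‖ + ‖x - d‖ := by
    calc ‖π d‖ = ‖π x - π (x - d)‖ := by rw [← map_sub, sub_sub_cancel]
      _ ≤ _ := (norm_sub_le _ _).trans
        (add_le_add le_rfl (NonUnitalStarAlgHom.norm_apply_le π (x - d)))
  calc ‖x - x * e‖ = ‖((x - c d) - (x - c d) * e) + (c d - c d * e)‖ := by
        rw [sub_mul]; congr 1; abel
    _ ≤ ‖x - c d‖ + ε / 3 := (norm_add_le _ _).trans (add_le_add h1 h2)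
    _ ≤ _ := by linarith [hc d]

/-- A continuous path of positive contractions in the ideal `ker π` that is asymptotically
central, asymptotically invariant, and asymptotically computes the quotient norm. -/
theorem exists_quasicentral_path {β : G →* (B ≃⋆ₐ[ℂ] B)} (hβ : IsContinuousAction β)
    (π : B →⋆ₙₐ[ℂ] Q) (hπβ : ∀ g b, π b = 0 → π (β g b) = 0)
    {K : ℕ → Set G} (hK : ∀ n, IsCompact (K n)) {L : ℕ → Set B} (hL : ∀ n, IsCompact (L n)) :
    ∃ u : ℝ → B, Continuous u ∧ ∀ t, 0 ≤ u t ∧ ‖u t‖ ≤ 1 ∧ π (u t) = 0 ∧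
      (∀ x ∈ L ⌊t⌋₊, ‖x - x * u t‖ ≤ ‖π x‖ + 1 / (⌊t⌋₊ + 1)) ∧
      (∀ x ∈ L ⌊t⌋₊, ‖u t * x - x * u t‖ ≤ 1 / (⌊t⌋₊ + 1)) ∧
      ∀ g ∈ K ⌊t⌋₊, ‖β g (u t) - u t‖ ≤ 1 / (⌊t⌋₊ + 1) := by
  -- Taking unions over `i ≤ n` makes both `e ⌊t⌋₊` and `e (⌊t⌋₊ + 1)` satisfy the estimates of
  -- stage `⌊t⌋₊`. These are convex conditions, so they pass to the interpolation.
  have hex (n : ℕ) := exists_quasicentral_norm_sub_mul_le hβ π hπβ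
    (K := ⋃ i ∈ Set.Iic n, K i) ((Set.finite_Iic n).isCompact_biUnion fun i _ => hK i)
    (L := ⋃ i ∈ Set.Iic n, L i) ((Set.finite_Iic n).isCompact_biUnion fun i _ => hL i)
    (ε := 1 / (n + 1)) (by positivity)
  choose e he0 he1 heπ heN heL heK using hex
  have hmono (n : ℕ) : (1 : ℝ) / ((n + 1 : ℕ) + 1) ≤ 1 / (n + 1) := by
    push_cast; gcongr; linarith
  refine ⟨interp fun n _ => e n, continuous_interp fun n => continuous_const, fun t => ?_⟩
  have hπsmul (a : ℝ) (b : B) : π (a • b) = a • π b := map_real_smul π (map_continuous π) a b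
  refine ⟨?_, ?_, ?_, fun x hx => ?_, fun x hx => ?_, fun g hg => ?_⟩
  · exact (convex_Ici (0 : B)).interp_mem (he0 _) (he0 _)
  · have := (convex_closedBall (0 : B) 1).interp_mem (F := fun n _ => e n) (t := t)
      (mem_closedBall_zero_iff.mpr (he1 _)) (mem_closedBall_zero_iff.mpr (he1 _))
    exact mem_closedBall_zero_iff.mp this
  · simp [interp, hπsmul, heπ]
  · have h0 := heN _ x (Set.subset_biUnion_of_mem (u := L) (Set.mem_Iic.mpr le_rfl) hx)
    have h1 := (heN _ x (Set.subset_biUnion_of_mem (u := L)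
      (Set.mem_Iic.mpr ⌊t⌋₊.le_succ) hx)).trans (add_le_add le_rfl (hmono _))
    rw [sub_eq_add_neg] at h0 h1 ⊢
    exact norm_add_map_interp_le (-LinearMap.mulLeft ℝ x) x h0 h1
  · have h0 := heL _ x (Set.subset_biUnion_of_mem (u := L) (Set.mem_Iic.mpr le_rfl) hx)
    have h1 := (heL _ x (Set.subset_biUnion_of_mem (u := L)
      (Set.mem_Iic.mpr ⌊t⌋₊.le_succ) hx)).trans (hmono _)
    rw [← zero_add (_ - _)] at h0 h1 ⊢
    exact norm_add_map_interp_le (LinearMap.mulRight ℝ x - LinearMap.mulLeft ℝ x) 0 h0 h1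
  · let T : B →ₗ[ℝ] B :=
      { toFun := fun b => β g b - b
        map_add' := fun a b => by rw [map_add]; abel
        map_smul' := fun r b => by
          have : β g (r • b) = r • β g b := map_real_smul (β g) (map_continuous (β g)) r b
          simp [this, smul_sub] }
    have h0 := heK _ g (Set.subset_biUnion_of_mem (u := K) (Set.mem_Iic.mpr le_rfl) hg)
    have h1 := (heK _ g (Set.subset_biUnion_of_mem (u := K)
      (Set.mem_Iic.mpr ⌊t⌋₊.le_succ) hg)).trans (hmono _)
    rw [← zero_add (_ - _)] at h0 h1 ⊢
    exact norm_add_map_interp_le T 0 h0 h1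

end Path

/-! ### Matrix amplifications. -/

section DiagonalMatrix

variable {B : Type*} [NonUnitalCStarAlgebra B]

/-- The diagonal embedding of a C⋆-algebra into its matrix algebra. -/
def diagonalHom (B : Type*) [NonUnitalCStarAlgebra B] (n : ℕ) :
    B →⋆ₙₐ[ℂ] CStarMatrix (Fin n) (Fin n) B where
  toFun u := CStarMatrix.ofMatrix (Matrix.diagonal fun _ => u)
  map_smul' c u := by
    ext i j
    by_cases h : i = j
    · subst h; simp [CStarMatrix.ofMatrix_apply]
    · simp [CStarMatrix.ofMatrix_apply, Matrix.diagonal_apply_ne _ h]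
  map_zero' := by
    ext i j
    simp [CStarMatrix.ofMatrix_apply]
  map_add' u v := by
    ext i j
    by_cases h : i = j
    · subst h; simp [CStarMatrix.ofMatrix_apply]
    · simp [CStarMatrix.ofMatrix_apply, Matrix.diagonal_apply_ne _ h]
  map_mul' u v := by
    ext i j
    rw [CStarMatrix.mul_apply]
    simp [CStarMatrix.ofMatrix_apply, Matrix.diagonal_apply]
  map_star' u := by
    ext i j
    rw [CStarMatrix.star_apply]
    by_cases h : i = j
    · subst h; simp [CStarMatrix.ofMatrix_apply]
    · simp [CStarMatrix.ofMatrix_apply, Matrix.diagonal_apply_ne _ h,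
        Matrix.diagonal_apply_ne _ (Ne.symm h)]

theorem diagonalHom_apply (n : ℕ) (u : B) (i j : Fin n) :
    diagonalHom B n u i j = if i = j then u else 0 := by
  change Matrix.diagonal (fun _ => u) i j = _
  rw [Matrix.diagonal_apply]

theorem compress_diagonalHom [PartialOrder B] [StarOrderedRing B] (n : ℕ) (u : B)
    (M : CStarMatrix (Fin n) (Fin n) B) :
    compress (diagonalHom B n u) M = M.map (compress u) := by
  ext i j
  simp [compress, CStarMatrix.mul_apply, diagonalHom_apply, CStarMatrix.map_apply]

theorem diagonalHom_nonneg [PartialOrder B] [StarOrderedRing B] (n : ℕ) {u : B} (hu : 0 ≤ u) :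
    0 ≤ diagonalHom B n u := map_nonneg (diagonalHom B n) hu

theorem CStarMatrix.map_isSelfAdjoint {A : Type*} [NonUnitalCStarAlgebra A] {n : ℕ} {f : A → B}
    (hf : ∀ a, f (star a) = star (f a)) {M : CStarMatrix (Fin n) (Fin n) A}
    (hM : IsSelfAdjoint M) : IsSelfAdjoint (M.map f) := by
  ext i j
  rw [CStarMatrix.star_apply, CStarMatrix.map_apply, CStarMatrix.map_apply, ← hf]
  congr 1
  nth_rw 2 [← hM.star_eq]
  rw [CStarMatrix.star_apply]

theorem tendsto_norm_cstarMatrix_map_sub [PartialOrder B] [StarOrderedRing B] {A ι : Type*}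
    {l : Filter ι} {f g : ι → A → B} {n : ℕ}
    (M : CStarMatrix (Fin n) (Fin n) A)
    (h : ∀ a, Tendsto (fun t => f t a - g t a) l (𝓝 0)) :
    Tendsto (fun t => ‖M.map (f t) - M.map (g t)‖) l (𝓝 0) := by
  rw [← tendsto_zero_iff_norm_tendsto_zero]
  have : Tendsto (fun t => (CStarMatrix.ofMatrix.symm (M.map (f t) - M.map (g t)) :
      Matrix (Fin n) (Fin n) B)) l (𝓝 0) := by
    refine tendsto_pi_nhds.mpr fun i => tendsto_pi_nhds.mpr fun j => ?_
    exact h (M i j)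
  exact this

end DiagonalMatrix

/-! ### Asymptotic Lipschitz bounds for asymptotically cp paths. -/

section AsymptoticBound

variable {A B : Type*} [NonUnitalCStarAlgebra A] [PartialOrder A] [StarOrderedRing A]
  [NonUnitalCStarAlgebra B] [PartialOrder B] [StarOrderedRing B]
  {ψ : Set.Ici (1 : ℝ) → A → B}

namespace IsAsymptoticallyCP

theorem tendsto_norm_negPart (hψ : IsAsymptoticallyCP ψ) {a : A} (ha : 0 ≤ a) :
    Tendsto (fun t => ‖(ψ t a)⁻‖) atTop (𝓝 0) := by
  have h := hψ.asymptotically_positive 1 (diagonalHom A 1 a) (diagonalHom_nonneg 1 ha)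
  refine squeeze_zero (fun _ => norm_nonneg _) (fun t => ?_) h
  have h1 : (diagonalHom A 1 a).map (ψ t) = diagonalHom B 1 (ψ t a) := by
    ext i j
    rw [CStarMatrix.map_apply, diagonalHom_apply, diagonalHom_apply,
      if_pos (Subsingleton.elim i j), if_pos (Subsingleton.elim i j)]
  have hs : IsSelfAdjoint (ψ t a) := by
    rw [IsSelfAdjoint, ← hψ.map_star, ha.isSelfAdjoint.star_eq]
  rw [cstarNegPart, h1, ← map_negPart _ hs]
  have := CStarMatrix.norm_entry_le_norm (M := diagonalHom B 1 (ψ t a)⁻) (i := 0) (j := 0)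
  rwa [diagonalHom_apply, if_pos rfl] at this

theorem tendsto_smul (hψ : IsAsymptoticallyCP ψ) (c : ℂ) (a : A) :
    Tendsto (fun t => ψ t (c • a) - c • ψ t a) atTop (𝓝 0) := by
  refine tendsto_zero_iff_norm_tendsto_zero.mpr ?_
  have := hψ.asymptotically_linear c 0 a a
  simpa using this

theorem tendsto_add (hψ : IsAsymptoticallyCP ψ) (a b : A) :
    Tendsto (fun t => ψ t (a + b) - ψ t a - ψ t b) atTop (𝓝 0) := by
  refine tendsto_zero_iff_norm_tendsto_zero.mpr ?_
  have := hψ.asymptotically_linear 1 1 a b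
  simpa using this

theorem tendsto_sub (hψ : IsAsymptoticallyCP ψ) (a b : A) :
    Tendsto (fun t => ψ t (a - b) - (ψ t a - ψ t b)) atTop (𝓝 0) := by
  refine tendsto_zero_iff_norm_tendsto_zero.mpr ?_
  have := hψ.asymptotically_linear 1 (-1) a b
  have e : (1 : ℂ) • a + (-1 : ℂ) • b = a - b := by simp [sub_eq_add_neg]
  simp only [e] at this
  refine this.congr fun t => congrArg norm ?_
  simp only [one_smul, neg_smul]; abel

/-- Asymptotically `ψ t b` is the sum of `ψ t a` and `ψ t (b - a)`, both almost positive, so the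
positive part of `ψ t a` is dominated by `ψ t b` plus small terms. -/
theorem eventually_norm_le_of_le (hψ : IsAsymptoticallyCP ψ) {a b : A} (ha : 0 ≤ a) (hab : a ≤ b)
    {C : ℝ} (hC : ∀ t, ‖ψ t b‖ ≤ C) : ∀ᶠ t in atTop, ‖ψ t a‖ ≤ C + 1 := by
  have h1 := hψ.tendsto_norm_negPart ha
  have h2 := hψ.tendsto_norm_negPart (sub_nonneg.mpr hab)
  have h3 := (hψ.tendsto_sub b a).norm
  rw [norm_zero] at h3
  have hsum := (h1.const_mul 2).add (h2.add h3)
  rw [mul_zero, zero_add, add_zero] at hsum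
  filter_upwards [hsum.eventually_lt_const one_pos] with t ht
  have hsa : ∀ c : A, 0 ≤ c → IsSelfAdjoint (ψ t c) := fun c hc => by
    rw [IsSelfAdjoint, ← hψ.map_star, hc.isSelfAdjoint.star_eq]
  set x := ψ t a with hx
  set y := ψ t (b - a) with hy
  set w := ψ t b - ψ t a - y
  have hxs := hsa a ha
  have hys := hsa _ (sub_nonneg.mpr hab)
  have hle : x⁺ ≤ ψ t b - w + y⁻ + x⁻ := by
    have e1 : x⁺ = x + x⁻ := sub_eq_iff_eq_add.mp (CFC.posPart_sub_negPart x hxs)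
    have e2 : -y⁻ ≤ y := CFC.neg_negPart_le hys
    have e3 : x = ψ t b - w - y := by simp only [w, ← hx]; abel
    rw [e1]
    have : x ≤ ψ t b - w + y⁻ := by
      rw [e3, sub_eq_add_neg (_ - w)]
      exact add_le_add le_rfl (neg_le.mp e2)
    exact add_le_add this le_rfl
  have hn : ‖x⁺‖ ≤ ‖ψ t b‖ + ‖w‖ + ‖y⁻‖ + ‖x⁻‖ := by
    refine (CStarAlgebra.norm_le_norm_of_nonneg_of_le (CFC.posPart_nonneg x) hle).trans ?_
    refine (norm_add_le _ _).trans (add_le_add ((norm_add_le _ _).trans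
      (add_le_add (norm_sub_le _ _) le_rfl)) le_rfl)
  have hx' : ‖x‖ ≤ ‖x⁺‖ + ‖x⁻‖ := by
    conv_lhs => rw [← CFC.posPart_sub_negPart x hxs]
    exact norm_sub_le _ _
  have hw : ‖w‖ = ‖y - (ψ t b - x)‖ := norm_sub_rev _ _
  have := hC t
  linarith

theorem eventually_norm_le_smul (hψ : IsAsymptoticallyCP ψ) {a : A} (c : ℂ) {C : ℝ}
    (h : ∀ᶠ t in atTop, ‖ψ t a‖ ≤ C) {ε : ℝ} (hε : 0 < ε) :
    ∀ᶠ t in atTop, ‖ψ t (c • a)‖ ≤ ‖c‖ * C + ε := by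
  have h1 := (hψ.tendsto_smul c a).norm
  rw [norm_zero] at h1
  filter_upwards [h, h1.eventually_lt_const hε] with t h2 h3
  calc ‖ψ t (c • a)‖ = ‖c • ψ t a + (ψ t (c • a) - c • ψ t a)‖ := by congr 1; abel
    _ ≤ ‖c‖ * C + ε := (norm_add_le _ _).trans (add_le_add (by rw [norm_smul]; gcongr) h3.le)

theorem eventually_norm_le_add (hψ : IsAsymptoticallyCP ψ) {a b : A} {C D : ℝ}
    (ha : ∀ᶠ t in atTop, ‖ψ t a‖ ≤ C) (hb : ∀ᶠ t in atTop, ‖ψ t b‖ ≤ D) :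
    ∀ᶠ t in atTop, ‖ψ t (a + b)‖ ≤ C + D + 1 := by
  have h1 := (hψ.tendsto_add a b).norm
  rw [norm_zero] at h1
  filter_upwards [ha, hb, h1.eventually_lt_const one_pos] with t h2 h3 h4
  calc ‖ψ t (a + b)‖ = ‖ψ t a + ψ t b + (ψ t (a + b) - ψ t a - ψ t b)‖ := by congr 1; abel
    _ ≤ _ := (norm_add_le _ _).trans
      (add_le_add ((norm_add_le _ _).trans (add_le_add h2 h3)) h4.le)

/-- Otherwise positive contractions `a n` exceed `4 ^ n` at arbitrarily late times. Their sum with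
weights `2⁻ⁿ` dominates each term, so the bound at the sum forces `‖ψ t (a n)‖` to be eventually at
most about `2 ^ n` times a constant. The threshold time depends on `a`. -/
theorem exists_bound_nonneg (hψ : IsAsymptoticallyCP ψ) :
    ∃ C : ℝ, ∀ a : A, 0 ≤ a → ‖a‖ ≤ 1 → ∀ᶠ t in atTop, ‖ψ t a‖ ≤ C := by
  by_contra! hcon
  choose a ha0 ha1 ha using fun n : ℕ => hcon ((4 : ℝ) ^ n)
  have hsum : Summable fun n => ((1 / 2 : ℝ) ^ n) • a n := by
    refine Summable.of_norm_bounded (g := fun n => (1 / 2 : ℝ) ^ n)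
      (summable_geometric_of_lt_one (by norm_num) (by norm_num)) fun n => ?_
    rw [norm_smul, Real.norm_of_nonneg (by positivity)]
    exact mul_le_of_le_one_right (by positivity) (ha1 n)
  have hnn : ∀ n, 0 ≤ ((1 / 2 : ℝ) ^ n) • a n := fun n => smul_nonneg (by positivity) (ha0 n)
  obtain ⟨C, hC⟩ := hψ.bounded (∑' n, ((1 / 2 : ℝ) ^ n) • a n)
  obtain ⟨n, hn⟩ := pow_unbounded_of_one_lt (C + 2) (one_lt_two (α := ℝ))
  have h1 := hψ.eventually_norm_le_of_le (hnn n) (hsum.le_tsum n fun j _ => hnn j) hC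
  have h2 := hψ.eventually_norm_le_smul (((2 : ℝ) ^ n : ℝ) : ℂ) h1 one_pos
  rw [Complex.norm_of_nonneg (by positivity)] at h2
  have h3 : (((2 : ℝ) ^ n : ℝ) : ℂ) • ((1 / 2 : ℝ) ^ n) • a n = a n := by
    rw [Complex.coe_smul, smul_smul, ← mul_pow]; norm_num
  rw [h3] at h2
  refine ha n ?_
  filter_upwards [h2] with t ht
  refine not_lt.mpr (ht.trans ?_)
  have h4 : (4 : ℝ) ^ n = 2 ^ n * 2 ^ n := by rw [← mul_pow]; norm_num
  have h5 : (1 : ℝ) ≤ 2 ^ n := one_le_pow₀ one_le_two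
  rw [h4]
  nlinarith

/-- An asymptotically completely positive path is asymptotically Lipschitz. -/
theorem exists_eventually_norm_sub_le (hψ : IsAsymptoticallyCP ψ) :
    ∃ C : ℝ, 0 < C ∧ ∀ a b : A, ∀ᶠ t in atTop, ‖ψ t a - ψ t b‖ ≤ C * ‖a - b‖ := by
  obtain ⟨C, hC⟩ := hψ.exists_bound_nonneg
  have h1 (a : A) (ha : ‖a‖ ≤ 1) : ∀ᶠ t in atTop, ‖ψ t a‖ ≤ 4 * |C| + 7 := by
    obtain ⟨x, hx, hxn, hxa⟩ := CStarAlgebra.exists_sum_four_nonneg a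
    have hi (i : Fin 4) : ∀ᶠ t in atTop, ‖ψ t (Complex.I ^ (i : ℕ) • x i)‖ ≤ C + 1 := by
      have := hψ.eventually_norm_le_smul (Complex.I ^ (i : ℕ)) (hC (x i) (hx i) ((hxn i).trans ha))
        one_pos
      simpa using this
    have h4 := hψ.eventually_norm_le_add (hψ.eventually_norm_le_add
      (hψ.eventually_norm_le_add (hi 0) (hi 1)) (hi 2)) (hi 3)
    rw [hxa, Fin.sum_univ_four]
    filter_upwards [h4] with t ht
    refine ht.trans ?_
    linarith [le_abs_self C]
  -- `4 * |C| + 7` on the unit ball, plus `‖a - b‖` once for rescaling and once for asymptotic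
  -- additivity.
  refine ⟨4 * |C| + 9, by positivity, fun a b => ?_⟩
  rcases eq_or_ne a b with rfl | hab
  · exact .of_forall fun t => by simp
  have hpos : 0 < ‖a - b‖ := norm_pos_iff.mpr (sub_ne_zero.mpr hab)
  have h2 := h1 (((‖a - b‖⁻¹ : ℝ) : ℂ) • (a - b)) (by
    rw [norm_smul, Complex.norm_of_nonneg (by positivity), inv_mul_cancel₀ hpos.ne'])
  have h3 := hψ.eventually_norm_le_smul ((‖a - b‖ : ℝ) : ℂ) h2 hpos
  rw [Complex.norm_of_nonneg hpos.le] at h3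
  rw [smul_smul, ← Complex.ofReal_mul, mul_inv_cancel₀ hpos.ne', Complex.ofReal_one, one_smul] at h3
  have h4 := (hψ.tendsto_sub a b).norm
  rw [norm_zero] at h4
  filter_upwards [h3, h4.eventually_lt_const hpos] with t h5 h6
  calc ‖ψ t a - ψ t b‖ = ‖ψ t (a - b) - (ψ t (a - b) - (ψ t a - ψ t b))‖ := by
        rw [sub_sub_cancel]
    _ ≤ _ := (norm_sub_le _ _).trans (add_le_add h5 h6.le)
    _ = _ := by ring

end IsAsymptoticallyCP

end AsymptoticBound

theorem tendsto_floor_Ici_atTop :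
    Tendsto (fun t : Set.Ici (1 : ℝ) => ⌊(t : ℝ)⌋₊) atTop atTop :=
  tendsto_nat_floor_atTop.comp (tendsto_comp_val_Ici_atTop.mpr tendsto_id)

/-! ### Compressing elements adapted to a dense sequence. -/

section CompressingPath

variable {G A B Q : Type*} [Group G] [TopologicalSpace G]
  [NonUnitalCStarAlgebra B] [PartialOrder B] [StarOrderedRing B]
  [NonUnitalCStarAlgebra Q]

/-- A path of positive contractions in `ker π` that is asymptotically central and invariant and
asymptotically computes the quotient norm for the values of `ψ` on the range of `d`. -/
structure IsCompressingPath (β : G →* (B ≃⋆ₐ[ℂ] B)) (π : B →⋆ₙₐ[ℂ] Q)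
    (ψ : Set.Ici (1 : ℝ) → A → B) (d : ℕ → A) (u : Set.Ici (1 : ℝ) → B) : Prop where
  continuous : Continuous u
  nonneg : ∀ t, 0 ≤ u t
  norm_le_one : ∀ t, ‖u t‖ ≤ 1
  map_eq_zero : ∀ t, π (u t) = 0
  commutator : ∀ i, ∀ ε > 0, ∀ᶠ t in atTop, ‖u t * ψ t (d i) - ψ t (d i) * u t‖ ≤ ε
  norm_sub_mul_le : ∀ i, ∀ ε > 0, ∀ᶠ t in atTop,
    ‖ψ t (d i) - ψ t (d i) * u t‖ ≤ ‖π (ψ t (d i))‖ + ε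
  norm_mul_sub_mul_le : ∀ i j, ∀ ε > 0, ∀ᶠ t in atTop,
    ‖ψ t (d i) * ψ t (d j) - ψ t (d i) * ψ t (d j) * u t‖ ≤ ‖π (ψ t (d i) * ψ t (d j))‖ + ε
  norm_action_sub_le : ∀ K : Set G, IsCompact K → ∀ ε > 0, ∀ᶠ t in atTop, ∀ g ∈ K,
    ‖β g (u t) - u t‖ ≤ ε
  norm_action_sub_sub_mul_le : ∀ K : Set G, IsCompact K → ∀ i j, ∀ ε > 0, ∀ᶠ t in atTop, ∀ g ∈ K,
    ‖(β g (ψ t (d i)) - ψ t (d j)) - (β g (ψ t (d i)) - ψ t (d j)) * u t‖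
      ≤ ‖π (β g (ψ t (d i)) - ψ t (d j))‖ + ε

/-- Stage `n` handles the indices up to `n`, the times up to `n + 1` and the `n`-th member of a
compact exhaustion of `G`. The corresponding values of `ψ`, products and displaced differences form
a compact set. -/
theorem exists_isCompressingPath [IsTopologicalGroup G] [LocallyCompactSpace G]
    [SecondCountableTopology G] [PartialOrder Q] [StarOrderedRing Q]
    {β : G →* (B ≃⋆ₐ[ℂ] B)} (hβ : IsContinuousAction β)
    (π : B →⋆ₙₐ[ℂ] Q) (hπβ : ∀ g b, π b = 0 → π (β g b) = 0) {ψ : Set.Ici (1 : ℝ) → A → B}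
    (hψ : ∀ a, Continuous fun t => ψ t a) (d : ℕ → A) :
    ∃ u, IsCompressingPath β π ψ d u := by
  let E : CompactExhaustion G := default
  let P : ℕ → Set (Set.Ici (1 : ℝ)) := fun n => {t | (t : ℝ) ≤ n + 1}
  have hP (n : ℕ) : IsCompact (P n) := by
    rw [Subtype.isCompact_iff]
    have : Subtype.val '' P n = Set.Icc (1 : ℝ) (n + 1) := by
      ext x; simp [P, and_comm, Set.Icc]
    rw [this]; exact isCompact_Icc
  let L1 : ℕ → ℕ → Set B := fun n i => (fun t => ψ t (d i)) '' P n
  let L2 : ℕ → ℕ → ℕ → Set B := fun n i j => (fun t => ψ t (d i) * ψ t (d j)) '' P n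
  let L3 : ℕ → ℕ → ℕ → Set B := fun n i j =>
    (fun p : G × Set.Ici (1 : ℝ) => β p.1 (ψ p.2 (d i)) - ψ p.2 (d j)) '' (E n ×ˢ P n)
  let L : ℕ → Set B := fun n => ⋃ i ∈ Set.Iic n, ⋃ j ∈ Set.Iic n, L1 n i ∪ (L2 n i j ∪ L3 n i j)
  have hL (n : ℕ) : IsCompact (L n) := by
    refine (Set.finite_Iic n).isCompact_biUnion fun i _ =>
      (Set.finite_Iic n).isCompact_biUnion fun j _ => ?_
    refine ((hP n).image (hψ _)).union (((hP n).image ((hψ _).mul (hψ _))).union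
      (((E.isCompact n).prod (hP n)).image ?_))
    have h1 := hβ.continuous_uncurry.comp
      (continuous_fst.prodMk ((hψ (d i)).comp continuous_snd) :
        Continuous fun p : G × Set.Ici (1 : ℝ) => (p.1, ψ p.2 (d i)))
    exact h1.sub ((hψ (d j)).comp continuous_snd)
  obtain ⟨u, huc, hu⟩ := exists_quasicentral_path hβ π hπβ (fun n => E.isCompact n) hL
  have hmem (t : Set.Ici (1 : ℝ)) : t ∈ P ⌊(t : ℝ)⌋₊ := (Nat.lt_floor_add_one (t : ℝ)).le
  have hLmem {i j : ℕ} {t : Set.Ici (1 : ℝ)} (hi : i ≤ ⌊(t : ℝ)⌋₊) (hj : j ≤ ⌊(t : ℝ)⌋₊) :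
      L1 ⌊(t : ℝ)⌋₊ i ∪ (L2 ⌊(t : ℝ)⌋₊ i j ∪ L3 ⌊(t : ℝ)⌋₊ i j) ⊆ L ⌊(t : ℝ)⌋₊ := fun x hx =>
    Set.mem_biUnion (show i ∈ Set.Iic _ from hi) (Set.mem_biUnion (show j ∈ Set.Iic _ from hj) hx)
  have hev (m : ℕ) : ∀ᶠ t : Set.Ici (1 : ℝ) in atTop, m ≤ ⌊(t : ℝ)⌋₊ :=
    tendsto_floor_Ici_atTop.eventually_ge_atTop m
  have hε (ε : ℝ) (h : 0 < ε) : ∀ᶠ t : Set.Ici (1 : ℝ) in atTop, 1 / ((⌊(t : ℝ)⌋₊ : ℝ) + 1) ≤ ε :=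
    ((tendsto_one_div_add_atTop_nhds_zero_nat (𝕜 := ℝ)).comp
      tendsto_floor_Ici_atTop).eventually_le_const h
  have hK {K : Set G} (hK : IsCompact K) : ∀ᶠ t : Set.Ici (1 : ℝ) in atTop, K ⊆ E ⌊(t : ℝ)⌋₊ := by
    obtain ⟨n, hn⟩ := E.exists_superset_of_isCompact hK
    filter_upwards [hev n] with t ht
    exact hn.trans (E.subset ht)
  refine ⟨fun t => u t,
    { continuous := huc.comp continuous_subtype_val
      nonneg := fun t => (hu t).1
      norm_le_one := fun t => (hu t).2.1
      map_eq_zero := fun t => (hu t).2.2.1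
      commutator := fun i ε h => ?_
      norm_sub_mul_le := fun i ε h => ?_
      norm_mul_sub_mul_le := fun i j ε h => ?_
      norm_action_sub_le := fun K hKc ε h => ?_
      norm_action_sub_sub_mul_le := fun K hKc i j ε h => ?_ }⟩
  · filter_upwards [hev i, hε ε h] with t hi ht
    exact ((hu t).2.2.2.2.1 _ (hLmem hi hi (.inl ⟨t, hmem t, rfl⟩))).trans ht
  · filter_upwards [hev i, hε ε h] with t hi ht
    exact ((hu t).2.2.2.1 _ (hLmem hi hi (.inl ⟨t, hmem t, rfl⟩))).trans (by gcongr)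
  · filter_upwards [hev i, hev j, hε ε h] with t hi hj ht
    exact ((hu t).2.2.2.1 _ (hLmem hi hj (.inr (.inl ⟨t, hmem t, rfl⟩)))).trans (by gcongr)
  · filter_upwards [hK hKc, hε ε h] with t hi ht g hg
    exact ((hu t).2.2.2.2.2 g (hi hg)).trans ht
  · filter_upwards [hK hKc, hev i, hev j, hε ε h] with t hKt hi hj ht g hg
    exact ((hu t).2.2.2.1 _ (hLmem hi hj (.inr (.inr ⟨(g, t), ⟨hKt hg, hmem t⟩, rfl⟩)))).trans
      (by gcongr)

end CompressingPath

theorem tendsto_of_forall_le_of_eventually_le_add {ι : Type*} {l : Filter ι} {f : ι → ℝ} {L : ℝ}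
    (h1 : ∀ t, L ≤ f t) (h2 : ∀ ε > 0, ∀ᶠ t in l, f t ≤ L + ε) : Tendsto f l (𝓝 L) := by
  refine tendsto_order.mpr ⟨fun a ha => .of_forall fun t => ha.trans_le (h1 t), fun a ha => ?_⟩
  filter_upwards [h2 ((a - L) / 2) (by linarith)] with t ht
  linarith

theorem norm_mul_sub_mul_le {R : Type*} [NonUnitalNormedRing R] (x y x' y' : R) :
    ‖x * y‖ ≤ ‖x' * y'‖ + ‖x - x'‖ * ‖y‖ + ‖x'‖ * ‖y - y'‖ := by
  calc ‖x * y‖ = ‖x' * y' + (x - x') * y + x' * (y - y')‖ := by congr 1; noncomm_ring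
    _ ≤ _ := (norm_add_le _ _).trans (add_le_add ((norm_add_le _ _).trans
      (add_le_add le_rfl (norm_mul_le _ _))) (norm_mul_le _ _))

theorem exists_pos_mul_le (C : ℝ) {ε : ℝ} (hε : 0 < ε) : ∃ η > 0, ∀ c ≤ C, 0 ≤ c → 2 * c * η ≤ ε :=
  ⟨ε / (2 * (|C| + 1)), by positivity, fun c hc hc0 => by
    rw [mul_div_assoc', div_le_iff₀ (by positivity)]
    nlinarith [le_abs_self C]⟩

/-! ### Norm limits for paths asymptotic to a compression. -/

section Conclusions

variable {G A B Q : Type*} [Group G] [TopologicalSpace G]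
  [NonUnitalCStarAlgebra A] [PartialOrder A] [StarOrderedRing A]
  [NonUnitalCStarAlgebra B] [PartialOrder B] [StarOrderedRing B]
  [NonUnitalCStarAlgebra Q] [PartialOrder Q] [StarOrderedRing Q]
  {α : G →* (A ≃⋆ₐ[ℂ] A)} {β : G →* (B ≃⋆ₐ[ℂ] B)} {γ : G →* (Q ≃⋆ₐ[ℂ] Q)}
  {π : B →⋆ₙₐ[ℂ] Q} {φ : A →CP Q} {ψ ψ' : Set.Ici (1 : ℝ) → A → B} {d : ℕ → A}
  {u : Set.Ici (1 : ℝ) → B}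

/-- The path `ψ'` is asymptotic to the compression of `ψ` by `u`, locally uniformly on `A`. -/
def IsLocallyAsymptotic (ψ : Set.Ici (1 : ℝ) → A → B) (u : Set.Ici (1 : ℝ) → B)
    (ψ' : Set.Ici (1 : ℝ) → A → B) : Prop :=
  ∀ a, Tendsto (fun p : Set.Ici (1 : ℝ) × A => ψ' p.1 p.2 - compress (u p.1) (ψ p.1 a))
    (atTop ×ˢ 𝓝 a) (𝓝 0)

omit [PartialOrder A] [StarOrderedRing A] [PartialOrder B] [StarOrderedRing B] in
theorem IsLocallyAsymptotic.tendsto (h : IsLocallyAsymptotic ψ u ψ') (a : A) :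
    Tendsto (fun t => ψ' t a - compress (u t) (ψ t a)) atTop (𝓝 0) :=
  (h a).comp (tendsto_id.prodMk (tendsto_const_nhds (x := a)))

theorem IsLocallyAsymptotic.isAsymptoticallyCP (h : IsLocallyAsymptotic ψ u ψ')
    (hψ : IsAsymptoticallyCP ψ) (hu0 : ∀ t, 0 ≤ u t) (hu1 : ∀ t, ‖u t‖ ≤ 1)
    (hc : ∀ a, Continuous fun t => ψ' t a) (hb : IsContractivePath ψ')
    (hs : ∀ t a, ψ' t (star a) = star (ψ' t a)) : IsAsymptoticallyCP ψ' where
  continuous_path := hc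
  bounded a := ⟨‖a‖, fun t => hb t a⟩
  map_star := hs
  asymptotically_linear μ ν a b := by
    rw [← tendsto_zero_iff_norm_tendsto_zero]
    have h1 : Tendsto (fun t => compress (u t) (ψ t (μ • a + ν • b) - μ • ψ t a - ν • ψ t b))
        atTop (𝓝 0) :=
      squeeze_zero_norm (fun t => norm_compress_le_norm (hu0 t) (hu1 t) _)
        (hψ.asymptotically_linear μ ν a b)
    have h2 := (((h.tendsto (μ • a + ν • b)).sub ((h.tendsto a).const_smul μ)).sub
      ((h.tendsto b).const_smul ν)).add h1
    simp only [smul_zero, sub_zero, add_zero] at h2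
    refine h2.congr fun t => ?_
    simp only [compress_sub, compress_smul, smul_sub]
    abel
  asymptotically_positive n M hM := by
    have h1 := tendsto_norm_cstarMatrix_map_sub M h.tendsto
    have h2 := (hψ.asymptotically_positive n M hM).add h1
    rw [add_zero] at h2
    refine squeeze_zero (fun _ => norm_nonneg _) (fun t => ?_) h2
    have hsM : IsSelfAdjoint (M.map (ψ t)) :=
      CStarMatrix.map_isSelfAdjoint (hψ.map_star t) hM.isSelfAdjoint
    have hχ : M.map (fun a => compress (u t) (ψ t a))
        = compress (diagonalHom B n (u t)) (M.map (ψ t)) := by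
      rw [compress_diagonalHom]; rfl
    have hd0 := diagonalHom_nonneg n (hu0 t)
    have hd1 : ‖diagonalHom B n (u t)‖ ≤ 1 :=
      (NonUnitalStarAlgHom.norm_apply_le (diagonalHom B n) (u t)).trans (hu1 t)
    refine (norm_negPart_le_add (CStarMatrix.map_isSelfAdjoint (hs t) hM.isSelfAdjoint)
      (y := M.map (fun a => compress (u t) (ψ t a))) ?_).trans (add_le_add ?_ le_rfl)
    · rw [hχ, IsSelfAdjoint, star_compress hd0.isSelfAdjoint, hsM.star_eq]
    · rw [hχ]; exact norm_negPart_compress_le hd0 hd1 hsM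

/-- The elements `u t` control `ψ` only along `d`; the asymptotic Lipschitz bound allows `a` to be
replaced by a nearby `d i`. -/
theorem IsLocallyAsymptotic.exists_eventually_norm_sub_le (h : IsLocallyAsymptotic ψ u ψ')
    (hψ : IsAsymptoticallyCP ψ) (hu0 : ∀ t, 0 ≤ u t) (hu1 : ∀ t, ‖u t‖ ≤ 1) (hd : DenseRange d)
    (a : A) {ε : ℝ} (hε : 0 < ε) :
    ∃ i, ‖d i - a‖ ≤ ε ∧ ∀ᶠ p : Set.Ici (1 : ℝ) × A in atTop ×ˢ 𝓝 a,
      ‖ψ' p.1 p.2 - compress (u p.1) (ψ p.1 (d i))‖ ≤ ε := by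
  obtain ⟨C, hC0, hC⟩ := hψ.exists_eventually_norm_sub_le
  obtain ⟨i, hi⟩ := hd.exists_dist_lt a (show 0 < min ε (ε / (2 * C)) by positivity)
  rw [dist_eq_norm] at hi
  refine ⟨i, by rw [norm_sub_rev]; exact hi.le.trans (min_le_left _ _), ?_⟩
  have h1 := (h a).norm
  rw [norm_zero] at h1
  filter_upwards [h1.eventually_lt_const (half_pos hε), (hC a (d i)).prod_inl (𝓝 a)] with p h2 h3
  have h4 : C * ‖a - d i‖ ≤ ε / 2 := by
    have := (le_div_iff₀ (by positivity)).mp (hi.le.trans (min_le_right _ _))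
    linarith
  calc _ = ‖(ψ' p.1 p.2 - compress (u p.1) (ψ p.1 a))
        + compress (u p.1) (ψ p.1 a - ψ p.1 (d i))‖ := by rw [compress_sub]; congr 1; abel
    _ ≤ ε / 2 + ε / 2 := (norm_add_le _ _).trans (add_le_add h2.le
        ((norm_compress_le_norm (hu0 _) (hu1 _) _).trans (h3.trans h4)))
    _ = ε := by ring

theorem norm_map_sub_map_le (hφ : ∀ a, ‖φ a‖ ≤ ‖a‖) (a b : A) : ‖φ a - φ b‖ ≤ ‖a - b‖ := by
  rw [← map_sub]; exact hφ _

theorem IsLocallyAsymptotic.tendsto_norm_mul (h : IsLocallyAsymptotic ψ u ψ')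
    (hψ : IsAsymptoticallyCP ψ) (hu : IsCompressingPath β π ψ d u) (hd : DenseRange d)
    (hφ : ∀ a, ‖φ a‖ ≤ ‖a‖) (hψφ : IsLiftPath π φ ψ) (hψ'φ : IsLiftPath π φ ψ')
    (hb : IsContractivePath ψ') (a b : A) :
    Tendsto (fun t => ‖ψ' t a * ψ' t b‖) atTop (𝓝 ‖φ a * φ b‖) := by
  refine tendsto_of_forall_le_of_eventually_le_add (fun t => ?_) fun ε₀ hε₀ => ?_
  · rw [← hψ'φ t a, ← hψ'φ t b, ← map_mul]
    exact NonUnitalStarAlgHom.norm_apply_le π _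
  -- The errors below add up to `ε * (2 + 2 * ‖a‖ + 2 * ‖b‖ + 2 * ε)`.
  set ε := min 1 (ε₀ / (2 * (2 + ‖a‖ + ‖b‖))) with hε
  have hε0 : 0 < ε := by positivity
  have hε1 : ε ≤ 1 := min_le_left _ _
  have hε2 : ε * (2 * (2 + ‖a‖ + ‖b‖)) ≤ ε₀ :=
    (le_div_iff₀ (by positivity)).mp (min_le_right _ _)
  obtain ⟨i, hi, hi'⟩ := h.exists_eventually_norm_sub_le hψ hu.nonneg hu.norm_le_one hd a hε0
  obtain ⟨j, hj, hj'⟩ := h.exists_eventually_norm_sub_le hψ hu.nonneg hu.norm_le_one hd b hε0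
  obtain ⟨C, hC⟩ := hψ.bounded (d i)
  obtain ⟨η, hη, hCη⟩ := exists_pos_mul_le C hε0
  filter_upwards [(tendsto_id.prodMk (tendsto_const_nhds (x := a))).eventually hi',
    (tendsto_id.prodMk (tendsto_const_nhds (x := b))).eventually hj',
    hu.norm_mul_sub_mul_le i j ε hε0, hu.commutator j η hη] with t h1 h2 h3 h4
  simp only [id] at h1 h2
  set x := compress (u t) (ψ t (d i))
  set y := compress (u t) (ψ t (d j))
  have e1 := norm_mul_sub_mul_le (ψ' t a) (ψ' t b) x y
  have e2 : ‖x‖ ≤ ‖a‖ + ε := by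
    have : ‖x‖ ≤ ‖ψ' t a‖ + ‖x - ψ' t a‖ := norm_le_insert' _ _
    rw [norm_sub_rev] at this
    exact this.trans (add_le_add (hb t a) h1)
  have e3 := norm_compress_mul_compress_le (hu.nonneg t) (hu.norm_le_one t) (ψ t (d i)) (ψ t (d j))
  have e4 : 2 * ‖ψ t (d i)‖ * ‖u t * ψ t (d j) - ψ t (d j) * u t‖ ≤ ε :=
    (mul_le_mul_of_nonneg_left h4 (by positivity)).trans (hCη _ (hC t) (norm_nonneg _))
  rw [map_mul, hψφ, hψφ] at h3
  have e5 := norm_mul_sub_mul_le (φ (d i)) (φ (d j)) (φ a) (φ b)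
  have e6 := (norm_map_sub_map_le hφ (d i) a).trans hi
  have e7 := (norm_map_sub_map_le hφ (d j) b).trans hj
  have e8 : ‖φ (d j)‖ ≤ ‖b‖ + ε :=
    (norm_le_insert' _ (φ b)).trans (add_le_add (hφ b) e7)
  have m1 : ‖ψ' t a - x‖ * ‖ψ' t b‖ ≤ ε * ‖b‖ := mul_le_mul h1 (hb t b) (norm_nonneg _) hε0.le
  have m2 : ‖x‖ * ‖ψ' t b - y‖ ≤ (‖a‖ + ε) * ε :=
    mul_le_mul e2 h2 (norm_nonneg _) (by positivity)
  have m3 : ‖φ (d i) - φ a‖ * ‖φ (d j)‖ ≤ ε * (‖b‖ + ε) :=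
    mul_le_mul e6 e8 (norm_nonneg _) hε0.le
  have m4 : ‖φ a‖ * ‖φ (d j) - φ b‖ ≤ ‖a‖ * ε :=
    mul_le_mul (hφ a) e7 (norm_nonneg _) (norm_nonneg _)
  nlinarith

theorem IsLocallyAsymptotic.eventually_norm_action_sub_le (h : IsLocallyAsymptotic ψ u ψ')
    (hα : IsContinuousAction α) (hγ : ∀ g b, π (β g b) = γ g (π b))
    (hψ : IsAsymptoticallyCP ψ) (hu : IsCompressingPath β π ψ d u) (hd : DenseRange d)
    (hφ : ∀ a, ‖φ a‖ ≤ ‖a‖) (hψφ : IsLiftPath π φ ψ) (a : A) {K : Set G} (hK : IsCompact K)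
    {ε : ℝ} (hε : 0 < ε) :
    ∀ᶠ t in atTop, ∀ k ∈ K, ∀ g ∈ K,
      ‖β g (ψ' t a) - ψ' t (α k a)‖ ≤ ‖γ g (φ a) - φ (α k a)‖ + ε := by
  -- Four errors `δ` arise in passing to compressions of `ψ` at `d i` and `d j`, three in returning
  -- to `φ a` and `φ (α k a)`.
  set δ := ε / 7 with hδ
  have hδ0 : 0 < δ := by positivity
  obtain ⟨i, hi, hi'⟩ := h.exists_eventually_norm_sub_le hψ hu.nonneg hu.norm_le_one hd a hδ0
  obtain ⟨C, hC⟩ := hψ.bounded (d i)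
  obtain ⟨η, hη, hCη⟩ := exists_pos_mul_le C hδ0
  -- The index `j` approximating `α k a` is fixed only near `k₀`, which is where local uniformity of
  -- the asymptotics is used. Compactness of `K` then yields one threshold in `t`.
  have key : ∀ k₀ ∈ K, {p : Set.Ici (1 : ℝ) × G | ∀ g ∈ K, ‖β g (ψ' p.1 a) - ψ' p.1 (α p.2 a)‖
      ≤ ‖γ g (φ a) - φ (α p.2 a)‖ + ε} ∈ atTop ×ˢ 𝓝 k₀ := by
    intro k₀ _
    obtain ⟨j, hj, hj'⟩ :=
      h.exists_eventually_norm_sub_le hψ hu.nonneg hu.norm_le_one hd (α k₀ a) hδ0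
    have hnear : ∀ᶠ k in 𝓝 k₀, ‖α k a - α k₀ a‖ < δ := by
      have := (tendsto_iff_norm_sub_tendsto_zero.mp ((hα a).tendsto k₀))
      exact this.eventually_lt_const hδ0
    have ht := (((tendsto_id.prodMk (tendsto_const_nhds (x := a))).eventually hi').and
      ((hu.norm_action_sub_le K hK η hη).and
        (hu.norm_action_sub_sub_mul_le K hK i j δ hδ0))).prod_inl (𝓝 k₀)
    filter_upwards [ht, hnear.prod_inr atTop,
      (tendsto_id.prodMap ((hα a).tendsto k₀)).eventually hj'] with p ⟨h1, h2, h3⟩ h4 h5 g hg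
    obtain ⟨t, k⟩ := p
    simp only [Prod.map, id] at h1 h2 h3 h4 h5
    have h2 := h2 g hg
    have h3 := h3 g hg
    rw [map_sub, hγ, hψφ, hψφ] at h3
    set x := compress (u t) (ψ t (d i)) with hx
    set y := compress (u t) (ψ t (d j)) with hy
    have e1 : ‖β g x - compress (u t) (β g (ψ t (d i)))‖ ≤ δ := by
      rw [hx, map_compress]
      refine (norm_compress_sub_compress_le (map_nonneg (β g) (hu.nonneg t))
        ((norm_action β g _).trans_le (hu.norm_le_one t)) (hu.nonneg t) (hu.norm_le_one t) _).trans ?_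
      rw [norm_action]
      calc 2 * ‖β g (u t) - u t‖ * ‖ψ t (d i)‖ ≤ 2 * η * ‖ψ t (d i)‖ := by gcongr
        _ = 2 * ‖ψ t (d i)‖ * η := by ring
        _ ≤ δ := hCη _ (hC t) (norm_nonneg _)
    have e2 : ‖compress (u t) (β g (ψ t (d i))) - y‖ ≤ ‖γ g (φ (d i)) - φ (d j)‖ + δ := by
      rw [hy, ← compress_sub]
      exact (norm_compress_le (hu.nonneg t) (hu.norm_le_one t) _).trans h3
    have e3 : ‖β g (ψ' t a) - β g x‖ ≤ δ := by rw [← map_sub, norm_action]; exact h1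
    have e4 : ‖γ g (φ (d i)) - φ (d j)‖ ≤ ‖γ g (φ a) - φ (α k a)‖ + δ + 2 * δ := by
      have f1 : ‖γ g (φ (d i)) - γ g (φ a)‖ ≤ δ := by
        rw [← map_sub, norm_action]; exact (norm_map_sub_map_le hφ _ _).trans hi
      have f2 : ‖φ (α k a) - φ (d j)‖ ≤ 2 * δ := by
        refine (norm_map_sub_map_le hφ _ _).trans ?_
        have := norm_sub_le_norm_sub_add_norm_sub (α k a) (α k₀ a) (d j)
        rw [norm_sub_rev] at hj
        linarith
      calc _ = ‖(γ g (φ a) - φ (α k a)) + (γ g (φ (d i)) - γ g (φ a)) + (φ (α k a) - φ (d j))‖ := by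
            congr 1; abel
        _ ≤ _ := (norm_add_le _ _).trans (add_le_add ((norm_add_le _ _).trans
          (add_le_add le_rfl f1)) f2)
    rw [norm_sub_rev] at h5
    calc ‖β g (ψ' t a) - ψ' t (α k a)‖ = ‖(β g (ψ' t a) - β g x)
          + (β g x - compress (u t) (β g (ψ t (d i))))
          + (compress (u t) (β g (ψ t (d i))) - y) + (y - ψ' t (α k a))‖ := by congr 1; abel
      _ ≤ δ + δ + (‖γ g (φ (d i)) - φ (d j)‖ + δ) + δ :=
        (norm_add_le _ _).trans (add_le_add ((norm_add_le _ _).trans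
          (add_le_add ((norm_add_le _ _).trans (add_le_add e3 e1)) e2)) h5)
      _ ≤ _ := by linarith
  have := hK.mem_prod_nhdsSet_of_forall key
  obtain ⟨s, hs, s', hs', hss⟩ := Filter.mem_prod_iff.mp this
  filter_upwards [hs] with t ht k hk
  exact hss (Set.mk_mem_prod ht (subset_of_mem_nhdsSet hs' hk))

end Conclusions

/-! ### Symmetrization under the involution. -/

section StarAverage

variable {A B Q : Type*} [NonUnitalCStarAlgebra A] [NonUnitalCStarAlgebra B]
  [NonUnitalCStarAlgebra Q] {π : B →⋆ₙₐ[ℂ] Q} {φ : A → Q} {ψ ψ' : Set.Ici (1 : ℝ) → A → B}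
  {u : Set.Ici (1 : ℝ) → B}

/-- The average of a path of maps with its conjugate under the involutions. -/
noncomputable def starAverage (ψ : Set.Ici (1 : ℝ) → A → B) : Set.Ici (1 : ℝ) → A → B :=
  fun t a => (1 / 2 : ℝ) • (ψ t a + star (ψ t (star a)))

theorem starAverage_star (t : Set.Ici (1 : ℝ)) (a : A) :
    starAverage ψ t (star a) = star (starAverage ψ t a) := by
  simp only [starAverage, star_star, star_smul, star_add, star_trivial, add_comm]

theorem continuous_starAverage (h : ∀ a, Continuous fun t => ψ t a) (a : A) :
    Continuous fun t => starAverage ψ t a :=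
  ((h a).add (continuous_star.comp (h (star a)))).const_smul _

theorem IsLiftPath.starAverage (hφ : ∀ a, φ (star a) = star (φ a)) (h : IsLiftPath π φ ψ) :
    IsLiftPath π φ (starAverage ψ) := fun t a => by
  have : π ((1 / 2 : ℝ) • (ψ t a + star (ψ t (star a))))
      = (1 / 2 : ℝ) • π (ψ t a + star (ψ t (star a))) := map_real_smul π (map_continuous π) _ _
  rw [_root_.starAverage, this, map_add, map_star, h, h, hφ, star_star, ← two_smul ℝ, smul_smul]
  norm_num

theorem IsContractivePath.starAverage (h : IsContractivePath ψ) :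
    IsContractivePath (starAverage ψ) := fun t a => by
  rw [_root_.starAverage, norm_smul, Real.norm_of_nonneg (by norm_num)]
  have h1 := h t a
  have h2 := h t (star a)
  have h3 := norm_add_le (ψ t a) (star (ψ t (star a)))
  rw [norm_star] at h2 h3
  linarith

theorem IsPositivePath.starAverage [PartialOrder A] [StarOrderedRing A] [PartialOrder B]
    [StarOrderedRing B] (h : IsPositivePath ψ) : IsPositivePath (starAverage ψ) := fun t a ha =>
  smul_nonneg (by norm_num) (add_nonneg (h t a ha)
    (star_nonneg_iff.mpr (h t _ (star_nonneg_iff.mpr ha))))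

theorem IsLocallyAsymptotic.starAverage (h : IsLocallyAsymptotic ψ u ψ')
    (hψ : ∀ t a, ψ t (star a) = star (ψ t a)) (hu : ∀ t, IsSelfAdjoint (u t)) :
    IsLocallyAsymptotic ψ u (starAverage ψ') := fun a => by
  have h1 := h a
  have h2 := ((h (star a)).comp (tendsto_id.prodMap (continuous_star.tendsto a))).star
  have h3 := (h1.add h2).const_smul (1 / 2 : ℝ)
  rw [star_zero, add_zero, smul_zero] at h3
  refine h3.congr fun p => ?_
  have : compress (u p.1) (ψ p.1 a)
      = (1 / 2 : ℝ) • (compress (u p.1) (ψ p.1 a) + compress (u p.1) (ψ p.1 a)) := by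
    rw [← two_smul ℝ, smul_smul]; norm_num
  simp only [Function.comp, Prod.map, id, star_sub, star_compress (hu _), hψ, star_star,
    _root_.starAverage]
  nth_rw 3 [this]
  rw [← smul_sub]; congr 1; abel

end StarAverage

/-! ### Enforcing contractivity and positivity. -/

section CutoffPath

variable {G A B Q : Type*} [Group G] [TopologicalSpace G]
  [NonUnitalCStarAlgebra A] [PartialOrder A] [StarOrderedRing A]
  [NonUnitalCStarAlgebra B] [PartialOrder B] [StarOrderedRing B]
  [NonUnitalCStarAlgebra Q] [PartialOrder Q] [StarOrderedRing Q]
  {β : G →* (B ≃⋆ₐ[ℂ] B)}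
  {π : B →⋆ₙₐ[ℂ] Q} {φ : A →CP Q} {ψ ψ' : Set.Ici (1 : ℝ) → A → B} {d : ℕ → A}
  {u : Set.Ici (1 : ℝ) → B}

open Classical in
/-- Modify a path of maps so that it becomes contractive and positive. -/
noncomputable def cutoffPath (ψ : Set.Ici (1 : ℝ) → A → B) : Set.Ici (1 : ℝ) → A → B :=
  fun t a => cutoff ‖a‖ (if 0 ≤ a then (ψ t a)⁺ else ψ t a)

omit [StarOrderedRing A] in
theorem isContractivePath_cutoffPath : IsContractivePath (cutoffPath ψ) :=
  fun _ a => norm_cutoff_le (norm_nonneg a) _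

omit [StarOrderedRing A] in
theorem isPositivePath_cutoffPath : IsPositivePath (cutoffPath ψ) := fun t a ha => by
  rw [cutoffPath, if_pos ha]
  exact cutoff_nonneg _ (CFC.posPart_nonneg _)

omit [PartialOrder B] [StarOrderedRing B] in
theorem isSelfAdjoint_of_map_star {ψ : A → B} (hs : ∀ a, ψ (star a) = star (ψ a)) {a : A}
    (ha : 0 ≤ a) : IsSelfAdjoint (ψ a) := by
  rw [IsSelfAdjoint, ← hs, ha.isSelfAdjoint.star_eq]

omit [PartialOrder B] [StarOrderedRing B] in
theorem continuous_cutoffPath (hs : ∀ t a, ψ t (star a) = star (ψ t a))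
    (h : ∀ a, Continuous fun t => ψ t a) (a : A) : Continuous fun t => cutoffPath ψ t a := by
  refine (continuous_cutoff ‖a‖).comp ?_
  split_ifs with ha
  · simp only [CFC.posPart_def]
    exact continuous_cfcₙ_of_isSelfAdjoint (by fun_prop) (by simp) (h a)
      fun t => isSelfAdjoint_of_map_star (hs t) ha
  · exact h a

omit [PartialOrder B] [StarOrderedRing B] in
theorem IsLiftPath.cutoffPath (hφ : ∀ a, ‖φ a‖ ≤ ‖a‖) (hs : ∀ t a, ψ t (star a) = star (ψ t a))
    (h : IsLiftPath π φ ψ) : IsLiftPath π φ (cutoffPath ψ) := fun t a => by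
  rw [_root_.cutoffPath, map_cutoff]
  split_ifs with ha
  · rw [map_posPart π (isSelfAdjoint_of_map_star (hs t) ha), h,
      (CFC.posPart_eq_self (φ a)).mpr (map_nonneg φ ha), cutoff_of_norm_le (norm_nonneg a) (hφ a)]
  · rw [h, cutoff_of_norm_le (norm_nonneg a) (hφ a)]

/-- The cutoff moves a value only by its excess norm and, on positive arguments, by its negative
part. Both vanish asymptotically: the first because compression brings the norm down to that of `φ`,
the second by asymptotic positivity. -/
theorem IsLocallyAsymptotic.cutoffPath (h : IsLocallyAsymptotic ψ u ψ')
    (hψ : IsAsymptoticallyCP ψ) (hu : IsCompressingPath β π ψ d u) (hd : DenseRange d)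
    (hφ : ∀ a, ‖φ a‖ ≤ ‖a‖) (hψφ : IsLiftPath π φ ψ)
    (hs : ∀ t a, ψ' t (star a) = star (ψ' t a)) : IsLocallyAsymptotic ψ u (cutoffPath ψ') := by
  intro a
  have hnorm : ∀ ε > 0, ∀ᶠ p : Set.Ici (1 : ℝ) × A in atTop ×ˢ 𝓝 a,
      ‖ψ' p.1 p.2‖ ≤ ‖p.2‖ + ε := by
    intro ε hε
    have hδ : 0 < ε / 4 := by positivity
    obtain ⟨i, hi, hi'⟩ := h.exists_eventually_norm_sub_le hψ hu.nonneg hu.norm_le_one hd a hδ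
    have hnear : ∀ᶠ a' in 𝓝 a, ‖a' - a‖ < ε / 4 :=
      (tendsto_iff_norm_sub_tendsto_zero.mp tendsto_id).eventually_lt_const hδ
    filter_upwards [hi', (hu.norm_sub_mul_le i _ hδ).prod_inl (𝓝 a), hnear.prod_inr atTop]
      with p h1 h2 h3
    rw [hψφ] at h2
    have h4 := (norm_compress_le (hu.nonneg p.1) (hu.norm_le_one p.1) _).trans h2
    have h5 := (norm_le_insert' _ _).trans (add_le_add h4 h1)
    have h6 := hφ (d i)
    have h7 : ‖d i‖ ≤ ‖a‖ + ‖d i - a‖ := norm_le_insert' _ _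
    have h8 : ‖a‖ ≤ ‖p.2‖ + ‖p.2 - a‖ := norm_le_insert _ _
    linarith
  have hneg : ∀ ε > 0, ∀ᶠ p : Set.Ici (1 : ℝ) × A in atTop ×ˢ 𝓝 a,
      0 ≤ p.2 → ‖(ψ' p.1 p.2)⁻‖ ≤ ε := by
    intro ε hε
    by_cases ha : 0 ≤ a
    · have h1 := (h a).norm
      rw [norm_zero] at h1
      filter_upwards [h1.eventually_lt_const (half_pos hε),
        ((hψ.tendsto_norm_negPart ha).eventually_lt_const (half_pos hε)).prod_inl (𝓝 a)]
        with p h2 h3 hp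
      have hsa := isSelfAdjoint_of_map_star (hψ.map_star p.1) ha
      have h4 := norm_negPart_compress_le (hu.nonneg p.1) (hu.norm_le_one p.1) hsa
      have h5 := norm_negPart_le_add (isSelfAdjoint_of_map_star (hs p.1) hp)
        (y := compress (u p.1) (ψ p.1 a)) (by
          rw [IsSelfAdjoint, star_compress (hu.nonneg p.1).isSelfAdjoint, hsa.star_eq])
      linarith
    -- The positive cone is closed, so near a non-positive `a` the condition is vacuous.
    · have h1 : ∀ᶠ a' in 𝓝 a, ¬ 0 ≤ a' :=
        (CStarAlgebra.isClosed_nonneg (A := A)).isOpen_compl.mem_nhds ha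
      filter_upwards [h1.prod_inr atTop] with p hp hp'
      exact absurd hp' hp
  have hdiff : Tendsto (fun p : Set.Ici (1 : ℝ) × A => _root_.cutoffPath ψ' p.1 p.2 - ψ' p.1 p.2)
      (atTop ×ˢ 𝓝 a) (𝓝 0) := by
    refine Metric.tendsto_nhds.mpr fun ε hε => ?_
    have hε3 : 0 < ε / 3 := by positivity
    filter_upwards [hnorm _ hε3, hneg _ hε3] with p h1 h2
    rw [dist_zero_right, _root_.cutoffPath]
    split_ifs with hp
    · have h3 := norm_cutoff_sub_le ‖p.2‖ (norm_nonneg _) (ψ' p.1 p.2)⁺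
      have h4 := CStarAlgebra.norm_posPart_le (ψ' p.1 p.2)
      have h5 : max 0 (‖(ψ' p.1 p.2)⁺‖ - ‖p.2‖) ≤ ε / 3 := max_le hε3.le (by linarith)
      have h6 : (ψ' p.1 p.2)⁺ - ψ' p.1 p.2 = (ψ' p.1 p.2)⁻ :=
        sub_eq_iff_eq_add.mpr (by
          rw [add_comm]
          exact sub_eq_iff_eq_add.mp (CFC.posPart_sub_negPart _
            (isSelfAdjoint_of_map_star (hs p.1) hp)))
      have h7 := norm_sub_le_norm_sub_add_norm_sub (cutoff ‖p.2‖ (ψ' p.1 p.2)⁺) (ψ' p.1 p.2)⁺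
        (ψ' p.1 p.2)
      rw [h6] at h7
      linarith [h2 hp]
    · have h3 := norm_cutoff_sub_le ‖p.2‖ (norm_nonneg _) (ψ' p.1 p.2)
      have h5 : max 0 (‖ψ' p.1 p.2‖ - ‖p.2‖) ≤ ε / 3 := max_le hε3.le (by linarith)
      linarith
  have := hdiff.add (h a)
  rw [add_zero] at this
  exact this.congr fun p => by abel

end CutoffPath

/-! ### From the dense sequence to all of `A`. -/

section Discretization

variable {G A B Q : Type*} [Group G] [TopologicalSpace G]
  [NonUnitalCStarAlgebra A] [PartialOrder A] [StarOrderedRing A]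
  [NonUnitalCStarAlgebra B] [PartialOrder B] [StarOrderedRing B]
  [NonUnitalCStarAlgebra Q] [PartialOrder Q] [StarOrderedRing Q]
  {β : G →* (B ≃⋆ₐ[ℂ] B)}
  {π : B →⋆ₙₐ[ℂ] Q} {φ : A →CP Q} {ψ ψ' : Set.Ici (1 : ℝ) → A → B} {d : ℕ → A}
  {u : Set.Ici (1 : ℝ) → B}

/-- Replacing an argument by its best approximation in a slowly growing finite subset of a dense
sequence, on which the path is uniformly Lipschitz, produces a locally asymptotic lift. -/
theorem exists_isLocallyAsymptotic (hπ : Function.Surjective π) (hφ : ∀ a, ‖φ a‖ ≤ ‖a‖)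
    (hψ : IsAsymptoticallyCP ψ) (hψφ : IsLiftPath π φ ψ) (hu : IsCompressingPath β π ψ d u)
    (hd : DenseRange d) :
    ∃ ψ' : Set.Ici (1 : ℝ) → A → B, (∀ a, Continuous fun t => ψ' t a) ∧ IsLiftPath π φ ψ' ∧
      IsLocallyAsymptotic ψ u ψ' := by
  obtain ⟨C, hC0, hC⟩ := hψ.exists_eventually_norm_sub_le
  -- At time `t` the interpolation uses the stages `⌊t⌋₊` and `⌊t⌋₊ + 1`, both at most `t + 1`.
  -- Hence stage `n` needs the Lipschitz bound exactly for `n ≤ t + 1`. Index `0` always qualifies,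
  -- and every index does eventually.
  let J : ℕ → Set ℕ := fun n => {k | k ≤ n ∧ ∀ i ≤ k, ∀ t : Set.Ici (1 : ℝ), (n : ℝ) ≤ t + 1 →
    ‖ψ t (d i) - ψ t (d k)‖ ≤ C * ‖d i - d k‖}
  have hJfin (n : ℕ) : (J n).Finite := (Set.finite_Iic n).subset fun k hk => hk.1
  have hJne (n : ℕ) : (J n).Nonempty :=
    ⟨0, n.zero_le, fun i hi t _ => by rw [Nat.le_zero.mp hi]; simp⟩
  have hJlip {n i k : ℕ} (hi : i ∈ J n) (hk : k ∈ J n) {t : Set.Ici (1 : ℝ)}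
      (ht : (n : ℝ) ≤ t + 1) : ‖ψ t (d i) - ψ t (d k)‖ ≤ C * ‖d i - d k‖ := by
    rcases le_total i k with h | h
    · exact hk.2 i h t ht
    · rw [norm_sub_rev, norm_sub_rev (d i)]; exact hi.2 k h t ht
  have hJev (k : ℕ) : ∀ᶠ n in atTop, k ∈ J n := by
    have h1 : ∀ᶠ t : Set.Ici (1 : ℝ) in atTop, ∀ i ∈ Set.Iic k,
        ‖ψ t (d i) - ψ t (d k)‖ ≤ C * ‖d i - d k‖ :=
      (Set.finite_Iic k).eventually_all.mpr fun i _ => hC (d i) (d k)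
    obtain ⟨T, hT⟩ := eventually_atTop.mp h1
    filter_upwards [eventually_ge_atTop k, eventually_ge_atTop ⌈(T : ℝ) + 1⌉₊] with n hn hn'
    refine ⟨hn, fun i hi t ht => hT t ?_ i hi⟩
    have := Nat.ceil_le.mp hn'
    exact Subtype.coe_le_coe.mp (by linarith)
  choose κ hκJ hκ using fun (n : ℕ) (a : A) =>
    Set.exists_min_image (J n) (fun k => ‖a - d k‖) (hJfin n) (hJne n)
  -- The correction restores the lift property exactly, and its norm is at most the approximation
  -- error.
  choose r hrπ hr using fun (n : ℕ) (a : A) => exists_lift_norm_le π hπ (φ (a - d (κ n a)))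
  let F : A → ℕ → ℝ → B := fun a n t =>
    compress (u (Set.projIci 1 t)) (ψ (Set.projIci 1 t) (d (κ n a))) + r n a
  refine ⟨fun t a => interp (F a) t, fun a => ?_, fun t a => ?_, fun a => ?_⟩
  · refine (continuous_interp fun n => ?_).comp continuous_subtype_val
    have hp : Continuous (Set.projIci (1 : ℝ)) :=
      (continuous_const.max continuous_id).subtype_mk _
    have h1 := hu.continuous.comp hp
    have h2 := (hψ.continuous_path (d (κ n a))).comp hp
    simp only [F, compress]
    exact ((h2.sub (h1.mul h2)).sub ((h2.sub (h1.mul h2)).mul h1)).add continuous_const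
  · have hF (n : ℕ) (s : ℝ) : π (F a n s) = φ a := by
      simp only [F]
      rw [map_add, map_compress, hu.map_eq_zero, compress_zero_left, hψφ, hrπ, map_sub]
      abel
    have h1 (c : ℝ) (b : B) : π (c • b) = c • π b := map_real_smul π (map_continuous π) c b
    change π (interp (F a) t) = φ a
    rw [interp, map_add, h1, h1, hF, hF, ← add_smul, sub_add_cancel, one_smul]
  · refine Metric.tendsto_nhds.mpr fun ε hε => ?_
    -- The selected `d k` is within `4 * η` of `d j`, which is within `η` of `a`, giving `5 * C *
    -- η`; the correction adds `2 * η`.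
    set η := ε / (2 * (5 * C + 2)) with hη
    have hη0 : 0 < η := by positivity
    have hηε : (5 * C + 2) * η < ε := by
      rw [hη, mul_div_assoc', div_lt_iff₀ (by positivity)]
      nlinarith [mul_pos hC0 hε]
    obtain ⟨j, hj⟩ := hd.exists_dist_lt a hη0
    rw [dist_eq_norm] at hj
    obtain ⟨N, hN⟩ := eventually_atTop.mp (hJev j)
    have hnear : ∀ᶠ a' in 𝓝 a, ‖a' - a‖ < η :=
      (tendsto_iff_norm_sub_tendsto_zero.mp tendsto_id).eventually_lt_const hη0
    filter_upwards [((tendsto_floor_Ici_atTop.eventually_ge_atTop N).and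
      (hC (d j) a)).prod_inl (𝓝 a), hnear.prod_inr atTop] with p ⟨h1, h2⟩ h3
    obtain ⟨t, a'⟩ := p
    simp only at h1 h2 h3
    have hproj : Set.projIci 1 (t : ℝ) = t := Set.projIci_coe t
    have hFn (n : ℕ) (hn : N ≤ n) (hnt : (n : ℝ) ≤ t + 1) :
        F a' n t ∈ Metric.closedBall (compress (u t) (ψ t a)) ((5 * C + 2) * η) := by
      rw [mem_closedBall_iff_norm]
      simp only [F, hproj]
      set k := κ n a'
      have e1 : ‖a' - d j‖ ≤ 2 * η := by
        have := norm_sub_le_norm_sub_add_norm_sub a' a (d j)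
        linarith
      have e2 : ‖a' - d k‖ ≤ 2 * η := (hκ n a' j (hN n hn)).trans e1
      have e3 : ‖d k - d j‖ ≤ 4 * η := by
        have := norm_sub_le_norm_sub_add_norm_sub (d k) a' (d j)
        rw [norm_sub_rev (d k) a'] at this
        linarith
      have e4 : ‖ψ t (d k) - ψ t (d j)‖ ≤ C * (4 * η) :=
        (hJlip (hκJ n a') (hN n hn) hnt).trans (by gcongr)
      have e5 : ‖ψ t (d j) - ψ t a‖ ≤ C * η := h2.trans (by rw [norm_sub_rev]; gcongr)
      have e6 : ‖ψ t (d k) - ψ t a‖ ≤ C * (4 * η) + C * η :=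
        (norm_sub_le_norm_sub_add_norm_sub _ _ _).trans (add_le_add e4 e5)
      have e7 : ‖r n a'‖ ≤ 2 * η := (hr n a').trans ((hφ _).trans e2)
      calc _ = ‖compress (u t) (ψ t (d k) - ψ t a) + r n a'‖ := by
            rw [compress_sub]; congr 1; abel
        _ ≤ (C * (4 * η) + C * η) + 2 * η := (norm_add_le _ _).trans (add_le_add
            ((norm_compress_le_norm (hu.nonneg t) (hu.norm_le_one t) _).trans e6) e7)
        _ = _ := by ring
    have ht0 : (0 : ℝ) ≤ t := zero_le_one.trans t.2
    have hfl := Nat.floor_le ht0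
    have := (convex_closedBall (compress (u t) (ψ t a)) ((5 * C + 2) * η)).interp_mem
      (F := F a') (t := t) (hFn _ h1 (by linarith))
      (hFn _ (h1.trans (Nat.le_succ _)) (by push_cast; linarith))
    rw [dist_zero_right]
    exact (mem_closedBall_iff_norm.mp this).trans_lt hηε

end Discretization

theorem proposition4p10
    {G : Type*} [Group G] [TopologicalSpace G] [IsTopologicalGroup G] [LocallyCompactSpace G]
    [SecondCountableTopology G]
    {A B Q : Type*}
    [NonUnitalCStarAlgebra A] [PartialOrder A] [StarOrderedRing A]
    [TopologicalSpace.SeparableSpace A]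
    [NonUnitalCStarAlgebra B] [PartialOrder B] [StarOrderedRing B]
    [NonUnitalCStarAlgebra Q] [PartialOrder Q] [StarOrderedRing Q]
    (α : G →* (A ≃⋆ₐ[ℂ] A)) (hα : IsContinuousAction α)
    (β : G →* (B ≃⋆ₐ[ℂ] B)) (hβ : IsContinuousAction β)
    -- `Q = B / I` with `I = ker π` a `G`-invariant ideal; `γ` is the induced action on `B / I`
    (π : B →⋆ₙₐ[ℂ] Q) (hπ : Function.Surjective π)
    (γ : G →* (Q ≃⋆ₐ[ℂ] Q)) (hγ : ∀ g b, π (β g b) = γ g (π b))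
    (φ : A →CP Q) (hφ : ∀ a, ‖φ a‖ ≤ ‖a‖)
    (ψ : Set.Ici (1 : ℝ) → A → B) (hψ : IsAsymptoticallyCP ψ) (hψφ : IsLiftPath π φ ψ) :
    ∃ ψ' : Set.Ici (1 : ℝ) → A → B,
      IsAsymptoticallyCP ψ' ∧ IsLiftPath π φ ψ' ∧
      (IsContractivePath ψ → IsContractivePath ψ') ∧
      (IsPositivePath ψ → IsPositivePath ψ') ∧
      (∀ a b : A, Tendsto (fun t => ‖ψ' t a * ψ' t b‖) atTop (𝓝 ‖φ a * φ b‖)) ∧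
      (∀ (a : A) (K : Set G), IsCompact K →
        TendstoUniformlyOn
          (fun t (p : G × G) => ‖β p.1 (ψ' t a) - ψ' t (α p.2 a)‖)
          (fun p : G × G => ‖γ p.1 (φ a) - φ (α p.2 a)‖) atTop (K ×ˢ K)) ∧
      (∀ (a : A) (K : Set G), IsCompact K →
        Tendsto
          (fun t => ⨆ p : ↥(K ×ˢ K), ‖β p.1.1 (ψ' t a) - ψ' t (α p.1.2 a)‖) atTop
          (𝓝 (⨆ p : ↥(K ×ˢ K), ‖γ p.1.1 (φ a) - φ (α p.1.2 a)‖))) ∧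
      ((∀ g a, φ (α g a) = γ g (φ a)) → IsAsymptoticallyEquivariant α β ψ') ∧
      (IsOrderZero φ → IsAsymptoticallyOrderZero ψ') := by
  let d : ℕ → A := TopologicalSpace.denseSeq A
  have hd : DenseRange d := TopologicalSpace.denseRange_denseSeq A
  obtain ⟨u, hu⟩ := exists_isCompressingPath hβ π
    (fun g b hb => by rw [hγ, hb, map_zero]) hψ.continuous_path d
  obtain ⟨ψ₀, hc₀, hl₀, ha₀⟩ := exists_isLocallyAsymptotic hπ hφ hψ hψφ hu hd
  have hφs (a : A) : φ (star a) = star (φ a) := by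
    have t : Set.Ici (1 : ℝ) := ⟨1, Set.mem_Ici.mpr le_rfl⟩
    rw [← hψφ t, ← hψφ t, hψ.map_star, map_star]
  have hus (t : Set.Ici (1 : ℝ)) : IsSelfAdjoint (u t) := (hu.nonneg t).isSelfAdjoint
  have hs₁ : ∀ t a, starAverage ψ₀ t (star a) = star (starAverage ψ₀ t a) := starAverage_star
  -- The inner average makes values at positive elements selfadjoint, so that positive parts make
  -- sense; the outer one secures selfadjointness after the cutoff.
  set ψ' := starAverage (cutoffPath (starAverage ψ₀)) with hψ'
  have hloc : IsLocallyAsymptotic ψ u ψ' :=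
    ((ha₀.starAverage hψ.map_star hus).cutoffPath hψ hu hd hφ hψφ hs₁).starAverage hψ.map_star hus
  have hlift : IsLiftPath π φ ψ' := ((hl₀.starAverage hφs).cutoffPath hφ hs₁).starAverage hφs
  have hcontr : IsContractivePath ψ' := isContractivePath_cutoffPath.starAverage
  have hmul := fun a b => hloc.tendsto_norm_mul hψ hu hd hφ hψφ hlift hcontr a b
  have hunif : ∀ (a : A) (K : Set G), IsCompact K → TendstoUniformlyOn
      (fun t (p : G × G) => ‖β p.1 (ψ' t a) - ψ' t (α p.2 a)‖)
      (fun p : G × G => ‖γ p.1 (φ a) - φ (α p.2 a)‖) atTop (K ×ˢ K) := by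
    intro a K hK
    refine Metric.tendstoUniformlyOn_iff.mpr fun ε hε => ?_
    filter_upwards [hloc.eventually_norm_action_sub_le hα hγ hψ hu hd hφ hψφ a hK (half_pos hε)]
      with t ht p hp
    have h1 := ht p.2 hp.2 p.1 hp.1
    have h2 : ‖γ p.1 (φ a) - φ (α p.2 a)‖ ≤ ‖β p.1 (ψ' t a) - ψ' t (α p.2 a)‖ := by
      rw [← hlift t a, ← hlift t (α p.2 a), ← hγ, ← map_sub]
      exact NonUnitalStarAlgHom.norm_apply_le π _
    rw [dist_comm, Real.dist_eq, abs_of_nonneg (sub_nonneg.mpr h2)]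
    linarith
  refine ⟨ψ', hloc.isAsymptoticallyCP hψ hu.nonneg hu.norm_le_one
    (continuous_starAverage (continuous_cutoffPath hs₁ (continuous_starAverage hc₀))) hcontr
    starAverage_star, hlift, fun _ => hcontr, fun _ => isPositivePath_cutoffPath.starAverage,
    hmul, hunif, fun a K hK => ?_, fun heq a K hK => ?_, fun h0 a b ha hb hab => ?_⟩
  · have hbdd : BddAbove (Set.range fun p : ↥(K ×ˢ K) =>
        ‖γ p.1.1 (φ a) - φ (α p.1.2 a)‖) := by
      refine ⟨‖a‖ + ‖a‖, ?_⟩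
      rintro _ ⟨p, rfl⟩
      refine (norm_sub_le _ _).trans (add_le_add ((norm_action γ _ _).trans_le (hφ a))
        ((hφ _).trans_eq (norm_action α _ _)))
    have hbdd' (t : Set.Ici (1 : ℝ)) : BddAbove (Set.range fun p : ↥(K ×ˢ K) =>
        ‖β p.1.1 (ψ' t a) - ψ' t (α p.1.2 a)‖) := by
      refine ⟨‖a‖ + ‖a‖, ?_⟩
      rintro _ ⟨p, rfl⟩
      refine (norm_sub_le _ _).trans (add_le_add ((norm_action β _ _).trans_le (hcontr t a))
        ((hcontr t _).trans_eq (norm_action α _ _)))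
    -- For empty `K` both suprema take the default value `0`.
    rcases isEmpty_or_nonempty ↥(K ×ˢ K) with hE | hE
    · simp only [Real.iSup_of_isEmpty]; exact tendsto_const_nhds
    refine Metric.tendsto_nhds.mpr fun ε hε => ?_
    filter_upwards [Metric.tendstoUniformlyOn_iff.mp (hunif a K hK) (ε / 2) (half_pos hε)]
      with t ht
    rw [Real.dist_eq]
    refine (abs_sub_le_iff.mpr ⟨?_, ?_⟩).trans_lt (half_lt_self hε)
    · rw [sub_le_iff_le_add']
      refine ciSup_le fun p => ?_
      have h1 := ht p p.2
      rw [Real.dist_eq] at h1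
      linarith [(abs_lt.mp h1).1, le_ciSup hbdd p]
    · rw [sub_le_iff_le_add']
      refine ciSup_le fun p => ?_
      have h1 := ht p p.2
      rw [Real.dist_eq] at h1
      linarith [(abs_lt.mp h1).2, le_ciSup (hbdd' t) p]
  · refine Metric.tendstoUniformlyOn_iff.mpr fun ε hε => ?_
    filter_upwards [Metric.tendstoUniformlyOn_iff.mp (hunif a K hK) ε hε] with t ht g hg
    have h1 := ht (g, g) ⟨hg, hg⟩
    simpa [heq] using h1
  · have := hmul a b
    rwa [h0 a b ha hb hab, norm_zero] at this
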